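/- Let $G$ be a simple, simply connected complex algebraic group with maximal torus $T$, character lattice $T^*$, (finite, reduced, irreducible) root system $\Phi\subset T^*$, simple roots $\alpha_1,\dots,\alpha_n$, highest root $\theta$, coroot lattice $Q^\vee$ and Weyl group $W$. Let $W_{\mathrm a}=Q^\vee\rtimes W$ be the affine Weyl group, with translations $t_\lambda$ ($\lambda\in Q^\vee$), simple reflections $s_i=s_{\alpha_i}$ ($1\le i\le n$), $s_0=t_{\theta^\vee}s_\theta$, and the corresponding length function. Let $W_{\mathrm a}^-\subset W_{\mathrm a}$ be the set of minimal length representatives of the cosets in $W_{\mathrm a}/W$. Let $R$ be a domain of characteristic $0$ and $F$ a one-dimensional commutative formal group law over $R$. Let $S$ be the formal group algebra of $T^*$: the power series ring over $R$ in variables $x_{\omega}$ indexed by a $\mathbb Z$-basis of $T^*$, with elements $x_\mu$ ($\mu\in T^*$) determined by $x_0=0$ and $x_{\mu+\nu}=F(x_\mu,x_\nu)$. If $F(x,y)=x+y-\mathfrak c\,xy$ with $\mathfrak c\in R$, one may also take for $S$ the polynomial version $R[x_\mu\mid\mu\in T^*]/(x_0,\ x_{\mu+\nu}-x_\mu-x_\nu+\mathfrak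 c\,x_\mu x_\nu)$. Let $W_{\mathrm a}$ act on $S$ by $(t_\lambda w)(x_\mu)=x_{w(\mu)}$, and put $\mathcal Q=S[1/x_\alpha\mid\alpha\in\Phi]$. Let $\mathcal Q_{W_{\mathrm a}}$ be the twisted group algebra, the free left $\mathcal Q$-module with basis $\eta_w$ ($w\in W_{\mathrm a}$) and product $p\,\eta_v\cdot q\,\eta_w=p\,v(q)\,\eta_{vw}$, and let $\mathcal Q_{Q^\vee}$ be the analogous algebra with basis $\eta_{t_\lambda}$ ($\lambda\in Q^\vee$). Let $\mathrm{pr}:\mathcal Q_{W_{\mathrm a}}\to\mathcal Q_{Q^\vee}$ be the left $\mathcal Q$-linear map with $\eta_{t_\lambda w}\mapsto\eta_{t_\lambda}$ for $w\in W$, and let $k:\mathcal Q_{Q^\vee}\to\mathcal Q_{W_{\mathrm a}}$ be the ring embedding $p\,\eta_{t_\lambda}\mapsto p\,\eta_{t_\lambda}$. Put $X_i=\frac1{x_{\alpha_i}}(1-\eta_{s_i})$ for $1\le i\le n$, $X_0=\frac1{x_{-\theta}}(1-\eta_{s_0})$, and $X_{I}=X_{i_1}\cdots X_{i_r}$ for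 a sequence $I=(i_1,\dots,i_r)$ in $\{0,\dots,n\}$. For every $w\in W_{\mathrm a}$ choose a reduced sequence $I_w$ of $w$, and assume that the choice is $W$-compatible: $I_{uv}$ is the concatenation of $I_u$ and $I_v$ for all $u\in W_{\mathrm a}^-$, $v\in W$. For $u\in W_{\mathrm a}^-$ put $\mathfrak X_{I_u}=\mathrm{pr}(X_{I_u})$. Then for every $u\in W_{\mathrm a}^-$ there are coefficients $c_{I_u,I_v}\in S$ ($v\in W_{\mathrm a}\setminus W_{\mathrm a}^-$), all but finitely many of them zero, such that $$k(\mathfrak X_{I_u})=X_{I_u}+\sum_{v\in W_{\mathrm a}\setminus W_{\mathrm a}^-}c_{I_u,I_v}X_{I_v}.$$ -/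

import Mathlib

noncomputable section
namespace FormalGroup

open MvPowerSeries

variable {R : Type*} [CommRing R] (F : FormalGroup R)

/-- Successive approximations to the formal inverse: `y₀ = 0`, `yₙ₊₁ = F(yₙ, -F(T, yₙ))`. -/
def invApprox : ℕ → MvPowerSeries Unit R
  | 0 => 0
  | n + 1 => F.toPowerSeries.subst ![invApprox n, -F.toPowerSeries.subst ![X (), invApprox n]]

/-- The formal inverse `i(T)`, the limit of the successive approximations. -/
def invSeries : MvPowerSeries Unit R := fun d => coeff d (F.invApprox (d ()))

lemma constantCoeff_subst_pair {σ : Type*} {f g : MvPowerSeries σ R}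
    (hf : constantCoeff f = 0) (hg : constantCoeff g = 0) :
    constantCoeff (F.toPowerSeries.subst ![f, g]) = 0 :=
  constantCoeff_subst_eq_zero
    (hasSubst_of_constantCoeff_zero (by intro s; fin_cases s <;> simp [hf, hg]))
    (by intro s; fin_cases s <;> simp [hf, hg]) F.zero_constantCoeff

lemma constantCoeff_invApprox (n : ℕ) : constantCoeff (F.invApprox n) = 0 := by
  induction n with
  | zero => simp [invApprox]
  | succ n ih =>
    refine F.constantCoeff_subst_pair ih ?_
    rw [map_neg, F.constantCoeff_subst_pair (by simp) ih, neg_zero]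

lemma two_le_order_sub : (2 : ℕ∞) ≤
    (F.toPowerSeries - (MvPowerSeries.X 0 + MvPowerSeries.X 1)).order := by
  classical
  refine nat_le_order (n := 2) fun d hd => ?_
  have hd' : d 0 + d 1 < 2 := by simpa [Finsupp.degree_eq_sum] using hd
  rcases Nat.eq_zero_or_pos (d 0) with h0 | h0 <;> rcases Nat.eq_zero_or_pos (d 1) with h1 | h1
  · have : d = 0 := by ext s; fin_cases s <;> simp [h0, h1]
    subst this
    have := F.zero_constantCoeff
    simp_all
  · have : d = Finsupp.single 1 1 := by
      ext s; fin_cases s <;> simp [h0]; omega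
    subst this
    simp [F.lin_coeff_Y, coeff_index_single_X]
  · have : d = Finsupp.single 0 1 := by
      ext s; fin_cases s <;> simp [h1]; omega
    subst this
    simp [F.lin_coeff_X, coeff_index_single_X]
  · omega

lemma order_subst_neg {σ : Type*} {f : MvPowerSeries σ R} (hf : constantCoeff f = 0) :
    f.order * 2 ≤ (F.toPowerSeries.subst ![f, -f]).order := by
  have hs : HasSubst ![f, -f] :=
    hasSubst_of_constantCoeff_zero (by intro s; fin_cases s <;> simp [hf])
  have h : F.toPowerSeries.subst ![f, -f] =
      (F.toPowerSeries - (MvPowerSeries.X 0 + MvPowerSeries.X 1)).subst ![f, -f] := by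
    rw [subst_sub hs, subst_add hs, subst_X hs, subst_X hs]
    simp
  rw [h]
  refine le_trans (mul_le_mul' ?_ F.two_le_order_sub) (le_order_subst hs _)
  refine le_iInf fun s => ?_
  fin_cases s <;> simp [order_neg]

lemma subst_X_invApprox_succ (n : ℕ) :
    F.toPowerSeries.subst ![X (), F.invApprox (n + 1)] =
      F.toPowerSeries.subst ![F.toPowerSeries.subst ![X (), F.invApprox n],
        -F.toPowerSeries.subst ![X (), F.invApprox n]] := by
  have h1 := F.constantCoeff_invApprox n
  have h2 := F.constantCoeff_subst_pair (f := X ()) (by simp) h1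
  rw [invApprox, F.assoc' (PowerSeries.HasSubst.of_constantCoeff_zero (by simp))
    (PowerSeries.HasSubst.of_constantCoeff_zero h1)
    (PowerSeries.HasSubst.of_constantCoeff_zero (by simp [h2]))]

lemma le_order_subst_X_invApprox (n : ℕ) :
    ((n + 1 : ℕ) : ℕ∞) ≤ (F.toPowerSeries.subst ![X (), F.invApprox n]).order := by
  induction n with
  | zero =>
    refine nat_le_order fun d hd => ?_
    have : d = 0 := by
      rw [← Finsupp.degree_eq_zero_iff]; omega
    subst this
    simpa using F.constantCoeff_subst_pair (f := X ()) (by simp) (F.constantCoeff_invApprox 0)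
  | succ n ih =>
    rw [subst_X_invApprox_succ]
    refine le_trans ?_ (F.order_subst_neg
      (F.constantCoeff_subst_pair (by simp) (F.constantCoeff_invApprox n)))
    refine le_trans ?_ (mul_le_mul' ih le_rfl)
    norm_cast
    omega

lemma truncTotal_subst_congr {σ : Type*} [Finite σ] {f f' g g' : MvPowerSeries σ R} {k : ℕ}
    (hf : constantCoeff f = 0) (hg : constantCoeff g = 0)
    (hf' : constantCoeff f' = 0) (hg' : constantCoeff g' = 0)
    (h : truncTotal k f = truncTotal k f') (h' : truncTotal k g = truncTotal k g') :
    truncTotal k (F.toPowerSeries.subst ![f, g]) =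
      truncTotal k (F.toPowerSeries.subst ![f', g']) := by
  rw [truncTotal_subst (a := ![f, g]) (by intro s; fin_cases s <;> simp [hf, hg]),
    truncTotal_subst (a := ![f', g']) (by intro s; fin_cases s <;> simp [hf', hg'])]
  congr 3
  ext1 s
  fin_cases s <;> simp [h, h']

lemma truncTotal_eq_zero {σ : Type*} [Finite σ] {f : MvPowerSeries σ R} {k : ℕ}
    (h : (k : ℕ∞) ≤ f.order) : truncTotal k f = 0 := by
  classical
  ext d
  rw [coeff_truncTotal_eq_ite]
  split_ifs with hd
  · simpa using coeff_of_lt_order (lt_of_lt_of_le (by exact_mod_cast hd) h)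
  · simp

lemma truncTotal_invApprox_succ (n : ℕ) :
    truncTotal (n + 1) (F.invApprox (n + 1)) = truncTotal (n + 1) (F.invApprox n) := by
  have h1 := F.constantCoeff_invApprox n
  have h2 := F.constantCoeff_subst_pair (f := X ()) (by simp) h1
  rw [invApprox, F.truncTotal_subst_congr (g' := 0) h1 (by simp [h2]) h1 (by simp) rfl,
    F.add_zero (PowerSeries.HasSubst.of_constantCoeff_zero h1)]
  rw [map_neg, truncTotal_eq_zero (F.le_order_subst_X_invApprox n)]
  simp

lemma coeff_invApprox {m n : ℕ} (h : m ≤ n) (d : Unit →₀ ℕ) (hd : d.degree ≤ m) :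
    coeff d (F.invApprox n) = coeff d (F.invApprox m) := by
  induction n, h using Nat.le_induction with
  | base => rfl
  | succ n hmn ih =>
    rw [← ih, ← coeff_truncTotal (n := n + 1) _ (by omega),
      ← coeff_truncTotal (n := n + 1) _ (by omega), truncTotal_invApprox_succ]

lemma constantCoeff_invSeries : constantCoeff F.invSeries = 0 := by
  rw [← coeff_zero_eq_constantCoeff_apply]
  change coeff 0 (F.invApprox 0) = 0
  simp [invApprox]

lemma subst_X_invSeries : F.toPowerSeries.subst ![X (), F.invSeries] = 0 := by
  refine MvPowerSeries.ext fun d => ?_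
  have h : truncTotal (d.degree + 1) F.invSeries =
      truncTotal (d.degree + 1) (F.invApprox d.degree) := by
    ext c
    by_cases hc : c.degree < d.degree + 1
    · rw [coeff_truncTotal _ hc, coeff_truncTotal _ hc,
        F.coeff_invApprox (Nat.lt_succ_iff.mp hc) c le_rfl]
      change coeff c (F.invApprox (c ())) = _
      simp [Finsupp.degree_eq_sum]
    · rw [coeff_truncTotal_eq_zero _ (not_lt.mp hc), coeff_truncTotal_eq_zero _ (not_lt.mp hc)]
  rw [← coeff_truncTotal (n := d.degree + 1) _ (by omega),
    F.truncTotal_subst_congr (by simp) F.constantCoeff_invSeries (by simp)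
      (F.constantCoeff_invApprox d.degree) rfl h,
    truncTotal_eq_zero (F.le_order_subst_X_invApprox d.degree)]
  simp

lemma subst_self_invSeries {σ : Type*} {f : MvPowerSeries σ R} (hf : PowerSeries.HasSubst f) :
    F.toPowerSeries.subst ![f, F.invSeries.subst (fun _ => f)] = 0 := by
  have h1 : HasSubst ![X (), F.invSeries] :=
    hasSubst_of_constantCoeff_zero (by
      intro s; fin_cases s <;> simp [F.constantCoeff_invSeries])
  have h := congrArg (MvPowerSeries.subst (fun _ : Unit => f)) F.subst_X_invSeries
  rw [subst_comp_subst_apply h1 hf.const, ← coe_substAlgHom hf.const, map_zero,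
    coe_substAlgHom] at h
  rw [← h]
  congr 1
  ext1 s
  fin_cases s
  · simp [subst_X hf.const]
  · simp

instance instNegPoint {σ : Type*} : Neg (F.Point σ) where
  neg f := ⟨F.invSeries.subst (fun _ => f.val),
    IsNilpotent_subst f.prop.const (F.constantCoeff_invSeries ▸ IsNilpotent.zero)⟩

instance instAddCommGroupPoint {σ : Type*} [F.IsComm] : AddCommGroup (F.Point σ) where
  zsmul := zsmulRec
  neg_add_cancel f := (add_comm (-f) f).trans (Subtype.ext (F.subst_self_invSeries f.prop))
  add_comm := add_comm

end FormalGroup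

namespace AffineFADA

/-! ### Formal group algebras -/

section FormalGroupAlgebra

open MvPowerSeries

variable {R : Type*} [CommRing R] (F : FormalGroup R) [F.IsComm]
  {L : Type*} [AddCommGroup L] {κ : Type*} (e : Module.Basis κ ℤ L)

/-- The homomorphism `μ ↦ x_μ` from the lattice `L` to the group of points of `F` in
`R⟦x_i | i ∈ κ⟧`, normalized by `x_{e i} = x_i`. -/
def fgaPoint : L →ₗ[ℤ] F.Point κ :=
  e.constr ℤ fun i => (⟨X i, PowerSeries.HasSubst.X i⟩ : F.Point κ)

/-- The element `x_μ` of the formal group algebra `R⟦x_i | i ∈ κ⟧` of the lattice `L` with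
basis `e`; that is, `x_μ = [m₁]x₁ +_F ⋯ +_F [mₙ]xₙ` for `μ = ∑ mᵢ eᵢ`. -/
def fgaVar (μ : L) : MvPowerSeries κ R := (fgaPoint F e μ).val

lemma hasSubst_fgaVar (μ : L) : PowerSeries.HasSubst (fgaVar F e μ) :=
  (fgaPoint F e μ).prop

@[simp] lemma fgaVar_basis (i : κ) : fgaVar F e (e i) = X i := by
  have h : fgaPoint F e (e i) = (⟨X i, PowerSeries.HasSubst.X i⟩ : F.Point κ) :=
    e.constr_basis ℤ _ i
  exact congrArg Subtype.val h

@[simp] lemma fgaVar_zero : fgaVar F e 0 = 0 := by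
  simp only [fgaVar, map_zero, FormalGroup.zero_apply]

lemma fgaVar_add (μ ν : L) :
    fgaVar F e (μ + ν) = F.toPowerSeries.subst ![fgaVar F e μ, fgaVar F e ν] := by
  simp only [fgaVar, map_add, FormalGroup.add_apply]

variable [Finite κ]

lemma hasSubst_fgaVar_comp (g : L → L) : HasSubst fun i => fgaVar F e (g (e i)) :=
  hasSubst_of_constantCoeff_nilpotent fun i => hasSubst_fgaVar F e (g (e i))

/-- The endomorphism of the formal group algebra induced by an endomorphism `g` of the lattice:
the continuous `R`-algebra map with `x_i = x_{e i} ↦ x_{g (e i)}`. -/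
def fgaMap (g : L →+ L) : MvPowerSeries κ R →ₐ[R] MvPowerSeries κ R :=
  substAlgHom (hasSubst_fgaVar_comp F e g)

lemma fgaMap_X (g : L →+ L) (i : κ) : fgaMap F e g (X i) = fgaVar F e (g (e i)) :=
  substAlgHom_X _ i

lemma fgaMap_subst (g : L →+ L) {p q : MvPowerSeries κ R} (hp : PowerSeries.HasSubst p)
    (hq : PowerSeries.HasSubst q) :
    fgaMap F e g (F.toPowerSeries.subst ![p, q]) =
      F.toPowerSeries.subst ![fgaMap F e g p, fgaMap F e g q] := by
  have h : HasSubst ![p, q] :=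
    hasSubst_of_constantCoeff_nilpotent (by intro s; fin_cases s <;> simpa)
  rw [fgaMap, coe_substAlgHom, subst_comp_subst_apply h (hasSubst_fgaVar_comp F e g)]
  congr 1
  ext1 s
  fin_cases s <;> rfl

lemma fgaMap_var (g : L →+ L) (μ : L) : fgaMap F e g (fgaVar F e μ) = fgaVar F e (g μ) := by
  let T : F.Point κ →+ F.Point κ :=
    { toFun := fun p => ⟨fgaMap F e g p.val,
        IsNilpotent_substAlgHom (hasSubst_fgaVar_comp F e g) p.prop⟩
      map_zero' := Subtype.ext (map_zero (fgaMap F e g))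
      map_add' := fun p q => Subtype.ext (fgaMap_subst F e g p.prop q.prop) }
  have h : T.toIntLinearMap ∘ₗ fgaPoint F e = fgaPoint F e ∘ₗ g.toIntLinearMap := by
    refine e.ext fun i => Subtype.ext ?_
    change fgaMap F e g (fgaVar F e (e i)) = fgaVar F e (g (e i))
    rw [fgaVar_basis, fgaMap_X]
  exact congrArg Subtype.val (LinearMap.congr_fun h μ)

lemma fgaMap_id : fgaMap F e (AddMonoidHom.id L) = AlgHom.id R _ := by
  refine AlgHom.ext fun p => ?_
  rw [fgaMap, coe_substAlgHom]
  simp only [AddMonoidHom.id_apply, fgaVar_basis]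
  exact congrFun subst_self p

lemma fgaMap_comp (g h : L →+ L) :
    fgaMap F e (g.comp h) = (fgaMap F e g).comp (fgaMap F e h) := by
  refine AlgHom.ext fun p => ?_
  rw [AlgHom.comp_apply]
  simp only [fgaMap, coe_substAlgHom]
  rw [subst_comp_subst_apply (hasSubst_fgaVar_comp F e h) (hasSubst_fgaVar_comp F e g)]
  congr 1
  ext1 i
  rw [← coe_substAlgHom (hasSubst_fgaVar_comp F e g)]
  exact (fgaMap_var F e g (h (e i))).symm

/-- The action on the formal group algebra of a group acting on the lattice. -/
def fgaAction (G : Type*) [Monoid G] [DistribMulAction G L] :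
    G →* (MvPowerSeries κ R →+* MvPowerSeries κ R) where
  toFun w := (fgaMap F e (DistribSMul.toAddMonoidHom L w)).toRingHom
  map_one' := by
    have : DistribSMul.toAddMonoidHom L (1 : G) = AddMonoidHom.id L := by ext; simp
    rw [this, fgaMap_id]
    rfl
  map_mul' v w := by
    have : DistribSMul.toAddMonoidHom L (v * w) =
      (DistribSMul.toAddMonoidHom L v).comp (DistribSMul.toAddMonoidHom L w) := by
      ext; simp [mul_smul]
    rw [this, fgaMap_comp]
    rfl

end FormalGroupAlgebra

section Connective

variable {R : Type*} [CommRing R] (c : R) (L : Type*) [AddCommGroup L]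

/-- The ideal of relations `x_0 = 0` and `x_{μ+ν} = x_μ + x_ν - c x_μ x_ν`. -/
def connIdeal : Ideal (MvPolynomial L R) :=
  Ideal.span ({MvPolynomial.X 0} ∪
    Set.range fun p : L × L => MvPolynomial.X (p.1 + p.2) -
      (MvPolynomial.X p.1 + MvPolynomial.X p.2
        - MvPolynomial.C c * MvPolynomial.X p.1 * MvPolynomial.X p.2))

/-- The polynomial version `R[x_μ | μ ∈ L]/(x_0, x_{μ+ν} - x_μ - x_ν + c x_μ x_ν)` of the formal
group algebra for the connective formal group law `x + y - c x y`. -/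
abbrev ConnAlgebra : Type _ := MvPolynomial L R ⧸ connIdeal c L

variable {L}

/-- The element `x_μ`. -/
def connVar (μ : L) : ConnAlgebra c L := Ideal.Quotient.mk _ (MvPolynomial.X μ)

lemma connIdeal_le_comap (g : L →+ L) :
    connIdeal c L ≤ (connIdeal c L).comap (MvPolynomial.rename (R := R) g).toRingHom := by
  rw [connIdeal, Ideal.span_le]
  rintro _ (rfl | ⟨⟨μ, ν⟩, rfl⟩)
  · refine Ideal.subset_span (Or.inl ?_)
    simp
  · refine Ideal.subset_span (Or.inr ⟨(g μ, g ν), ?_⟩)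
    simp

/-- The endomorphism `x_μ ↦ x_{g μ}`. -/
def connMap (g : L →+ L) : ConnAlgebra c L →+* ConnAlgebra c L :=
  Ideal.quotientMap _ (MvPolynomial.rename (R := R) g).toRingHom (connIdeal_le_comap c g)

lemma connMap_var (g : L →+ L) (μ : L) : connMap c g (connVar c μ) = connVar c (g μ) := by
  simp [connMap, connVar]

/-- The action on the polynomial formal group algebra of a group acting on the lattice. -/
def connAction (G : Type*) [Monoid G] [DistribMulAction G L] :
    G →* (ConnAlgebra c L →+* ConnAlgebra c L) where
  toFun w := connMap c (DistribSMul.toAddMonoidHom L w)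
  map_one' := by
    refine Ideal.Quotient.ringHom_ext (MvPolynomial.ringHom_ext (fun r => ?_) fun μ => ?_)
    · simp [connMap]
    · simp [connMap]
  map_mul' v w := by
    refine Ideal.Quotient.ringHom_ext (MvPolynomial.ringHom_ext (fun r => ?_) fun μ => ?_)
    · simp [connMap]
    · simp [connMap, mul_smul]

end Connective

/-! ### The twisted group algebras of the affine Weyl group and of the coroot lattice -/

section Affine

variable {ι L N : Type*} [AddCommGroup L] [AddCommGroup N] (P : RootPairing ι ℤ L N)

/-- A root pairing over `ℤ` is simple if it has roots and its roots are not the union of two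
nonempty orthogonal subsets. -/
def IsSimple : Prop :=
  Nonempty ι ∧ ∀ s : Set ι, s.Nonempty → (∀ i ∈ s, ∀ j ∉ s, P.pairing i j = 0) → s = Set.univ

/-- The action of the Weyl group on the cocharacter lattice, `w ↦ (λ ↦ w(λ))`; on `N` the
automorphism group of `P` acts from the right, whence the inverse. -/
def cocharAction : P.weylGroup →* MulAut (Multiplicative N) where
  toFun w := AddEquiv.toMultiplicative
    (DistribMulAction.toAddEquiv N (MulOpposite.op ((w⁻¹ : P.weylGroup) : P.Aut)))
  map_one' := by
    refine MulEquiv.ext fun x => Multiplicative.toAdd.injective ?_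
    simp
  map_mul' v w := by
    refine MulEquiv.ext fun x => Multiplicative.toAdd.injective ?_
    change MulOpposite.op (((v * w)⁻¹ : P.weylGroup) : P.Aut) • x.toAdd =
      MulOpposite.op ((v⁻¹ : P.weylGroup) : P.Aut) •
        MulOpposite.op ((w⁻¹ : P.weylGroup) : P.Aut) • x.toAdd
    rw [mul_inv_rev, Subgroup.coe_mul, MulOpposite.op_mul, mul_smul]

/-- The affine Weyl group `N ⋊ W`, where `N` is the coroot lattice; `⟨λ, w⟩` is `t_λ w`. -/
abbrev AffineWeyl : Type _ := Multiplicative N ⋊[cocharAction P] P.weylGroup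

/-- The translation `t_λ`. -/
def translation (l : N) : AffineWeyl P := SemidirectProduct.inl (Multiplicative.ofAdd l)

/-- The inclusion of the finite Weyl group. -/
def finiteWeyl (w : P.weylGroup) : AffineWeyl P := SemidirectProduct.inr w

variable {P} (b : P.Base) (θ : ι)

/-- `θ` is the highest root: every root is `θ` minus a sum of simple roots. -/
def IsHighestRoot : Prop :=
  ∀ i, P.root θ - P.root i ∈ AddSubmonoid.closure (P.root '' (b.support : Set ι))

/-- Indices of the affine simple roots: `none` is the extra node `0`. -/
abbrev AffineIndex : Type _ := Option b.support

/-- The affine simple reflections: `s_i` for `i` a simple root, and `s_0 = t_{θ^∨} s_θ`. -/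
def simpleRefl : AffineIndex b → AffineWeyl P
  | none => translation P (P.coroot θ) * finiteWeyl P (RootPairing.weylGroup.ofIdx P θ)
  | some i => finiteWeyl P (RootPairing.weylGroup.ofIdx P i)

/-- The element of the affine Weyl group spelled by a sequence of affine indices. -/
def wordProd (I : List (AffineIndex b)) : AffineWeyl P := (I.map (simpleRefl b θ)).prod

/-- The length: the least length of a sequence spelling `w`. -/
def len (w : AffineWeyl P) : ℕ := sInf {n | ∃ I, wordProd b θ I = w ∧ I.length = n}

/-- `I` is a reduced sequence of `w`. -/
def IsReducedSeq (I : List (AffineIndex b)) (w : AffineWeyl P) : Prop :=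
  wordProd b θ I = w ∧ I.length = len b θ w

/-- The set `W_a^-` of minimal length representatives of the cosets in `W_a / W`. -/
def minReps : Set (AffineWeyl P) :=
  {u | ∀ v : P.weylGroup, len b θ u ≤ len b θ (u * finiteWeyl P v)}

/-- `(I_w)` is a `W`-compatible choice of reduced sequences of the elements of `W_a`. -/
structure IsWCompatible (I : AffineWeyl P → List (AffineIndex b)) : Prop where
  reduced : ∀ w, IsReducedSeq b θ (I w) w
  append : ∀ u ∈ minReps b θ, ∀ v : P.weylGroup,
    I (u * finiteWeyl P v) = I u ++ I (finiteWeyl P v)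

/-- The root whose `x` is inverted in the Demazure element: `α_i` for `i` a simple root, and
`-θ = s_θ(θ)`, the image of `α_0 = -θ + δ`, for the extra node. -/
def simpleRootIdx : AffineIndex b → ι
  | none => P.reflectionPerm θ θ
  | some i => i

variable (P)

/-- A commutative ring `S` with an action of the Weyl group and elements `x_μ`, indexed
equivariantly by the characters `μ`. It is a common interface to the formal group algebra and its
polynomial version. -/
structure CoeffRing where
  carrier : Type*
  [commRing : CommRing carrier]
  act : P.weylGroup →* (carrier →+* carrier)
  x : L → carrier
  act_x : ∀ (w : P.weylGroup) (μ : L), act w (x μ) = x (w • μ)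

attribute [instance] CoeffRing.commRing

/-- The formal group algebra `S = R⟦T^*⟧_F` of the character lattice, in coordinates given by a
basis of the lattice. -/
def powerSeriesRing {R : Type*} [CommRing R] (F : FormalGroup R) [F.IsComm]
    {κ : Type*} [Finite κ] (e : Module.Basis κ ℤ L) : CoeffRing P where
  carrier := MvPowerSeries κ R
  act := fgaAction F e P.weylGroup
  x := fgaVar F e
  act_x w μ := fgaMap_var F e (DistribSMul.toAddMonoidHom L w) μ

/-- The polynomial version of the formal group algebra for `x + y - c x y`. -/
def connectiveRing {R : Type*} [CommRing R] (c : R) : CoeffRing P where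
  carrier := ConnAlgebra c L
  act := connAction c P.weylGroup
  x := connVar c
  act_x w μ := connMap_var c (DistribSMul.toAddMonoidHom L w) μ

variable {P} (S : CoeffRing P)

namespace CoeffRing

/-- The multiplicative set generated by the `x_α`, `α` a root. -/
def rootMonoid : Submonoid S.carrier := Submonoid.closure (Set.range fun i => S.x (P.root i))

lemma x_root_mem (i : ι) : S.x (P.root i) ∈ S.rootMonoid :=
  Submonoid.subset_closure ⟨i, rfl⟩

lemma rootMonoid_le_comap (w : P.weylGroup) : S.rootMonoid ≤ S.rootMonoid.comap (S.act w) := by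
  rw [rootMonoid, Submonoid.closure_le]
  rintro _ ⟨i, rfl⟩
  refine Submonoid.subset_closure ⟨P.weylGroupToPerm w i, ?_⟩
  simp only [S.act_x, P.weylGroup_apply_root]

/-- The ring `Q = S[1/x_α, α ∈ Φ]`. -/
abbrev Q : Type _ := Localization S.rootMonoid

/-- The element `1/x_α` of `Q`. -/
def invX (i : ι) : S.Q := IsLocalization.mk' S.Q 1 ⟨S.x (P.root i), S.x_root_mem i⟩

/-- The action of the Weyl group on `Q`. -/
def actQ : P.weylGroup →* (S.Q →+* S.Q) where
  toFun w := IsLocalization.map S.Q (S.act w) (S.rootMonoid_le_comap w)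
  map_one' := by
    refine IsLocalization.ringHom_ext S.rootMonoid (RingHom.ext fun a => ?_)
    simp
  map_mul' v w := by
    refine IsLocalization.ringHom_ext S.rootMonoid (RingHom.ext fun a => ?_)
    simp

/-- The action of the affine Weyl group on `Q`; translations act trivially. -/
instance affineAction : MulSemiringAction (AffineWeyl P) S.Q :=
  MulSemiringAction.compHom S.Q (S.actQ.comp SemidirectProduct.rightHom)

/-- The (trivial) action of the group of translations on `Q`. -/
instance translationAction : MulSemiringAction (Multiplicative N) S.Q :=
  MulSemiringAction.compHom S.Q (SemidirectProduct.inl : Multiplicative N →* AffineWeyl P)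

/-- The twisted group algebra `Q_{W_a}`, with `Q`-basis `η_w = single w 1` and product
`(p η_v) (q η_w) = p v(q) η_{vw}`. -/
abbrev QW : Type _ := SkewMonoidAlgebra S.Q (AffineWeyl P)

/-- The twisted group algebra `Q_{Q^∨}`, with `Q`-basis `η_{t_λ}`. -/
abbrev QT : Type _ := SkewMonoidAlgebra S.Q (Multiplicative N)

/-- The basis element `η_w`. -/
def η (w : AffineWeyl P) : S.QW := SkewMonoidAlgebra.single w 1

/-- The Demazure elements `X_i = (1/x_{α_i}) (1 - η_{s_i})` and `X_0 = (1/x_{-θ}) (1 - η_{s_0})`. -/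
def demazure (i : AffineIndex b) : S.QW :=
  S.invX (simpleRootIdx b θ i) • (1 - S.η (simpleRefl b θ i))

/-- The product `X_I` of Demazure elements along a sequence. -/
def demazureSeq (I : List (AffineIndex b)) : S.QW := (I.map (S.demazure b θ)).prod

/-- The projection `pr : Q_{W_a} → Q_{Q^∨}`, the map of left `Q`-modules with
`η_{t_λ w} ↦ η_{t_λ}`. -/
def pr : S.QW →ₗ[S.Q] S.QT where
  __ := SkewMonoidAlgebra.mapDomain fun w : AffineWeyl P => w.left
  map_smul' _ _ := SkewMonoidAlgebra.mapDomain_smul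

/-- The ring embedding `k : Q_{Q^∨} → Q_{W_a}`, `p η_{t_λ} ↦ p η_{t_λ}`. -/
def k : S.QT →+* S.QW :=
  SkewMonoidAlgebra.mapDomainRingHom
    (f := (SemidirectProduct.inl : Multiplicative N →* AffineWeyl P)) fun _ _ => rfl

end CoeffRing

end Affine

end AffineFADA

end

/-! Membership. The `S`-span of all products `X_I` (`demazureSpan`) is closed under multiplication
and contains every `η_w` and, for every affine root `γ = α + mδ`, the element `X_γ = (1/x_α)(1 -
η_{s_γ})`. The identity `k(pr(X_γ z)) = X_γ k(pr z) + η_{s_γ} k(pr z) X_{-α}` of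
`k_pr_rootDemazure_mul` then shows, by induction on the word, that `k(pr(X_I))` lies in this span.

Straightening. The products along the chosen reduced words must span everything. Over `S` the affine
roots `α + mδ` share one element `x_α`, so poles along different affine roots cannot be told apart.
One therefore deforms: over the formal group algebra `A` of the affine root lattice, the elements
`ξ_γ` of affine roots different up to sign are coprime. There each `X_I` satisfies a residue
condition along every `γ`: poles are simple, and the residues of the coefficients at `w` and `s_γ w`
are opposite (`residue_demSeq`). Conversely, if an element satisfies these conditions, its
coefficient at a `w` of maximal length is an `A`-multiple of the leading coefficient of `X_{I_w}`
(`exists_coeff_eq_mul_leadCoeff`). Subtracting top layers and descending on the length gives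
`mem_span_of_residue`, and `δ ↦ 0` carries the result to `S` (`demazureSeq_mem_span`).

Vanishing at minimal representatives. Now `k(pr(X_{I_u})) - X_{I_u}` is a combination of the
`X_{I_v}`. Apply `pr`. The left side dies because `pr ∘ k = id`. The terms with `v` not minimal die
because `I_v` ends in a finite simple reflection. The `pr(X_{I_v})` with `v` minimal are linearly
independent by triangularity, so minimal `v` contribute nothing. -/

/-! ### Reflection systems -/

noncomputable section
namespace AffineFADA

/-- A group `W` with a set of involutive generators `s j`, acting on a set `Γ` of roots with signs,
such that the only positive root made negative by `s j` is the simple root `root j`. -/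
structure ReflectionSystem (W J Γ : Type*) [Group W] [MulAction W Γ] where
  s : J → W
  root : J → Γ
  refl : Γ → W
  pos : Γ → Prop
  refl_smul : ∀ w γ, refl (w • γ) = w * refl γ * w⁻¹
  refl_root : ∀ j, refl (root j) = s j
  refl_mul_self : ∀ γ, refl γ * refl γ = 1
  pos_root : ∀ j, pos (root j)
  pos_neg : ∀ γ, pos (refl γ • γ) ↔ ¬ pos γ
  eq_root : ∀ j γ, pos γ → ¬ pos (s j • γ) → γ = root j
  exists_word : ∀ w, ∃ I : List J, (I.map s).prod = w

namespace ReflectionSystem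

variable {W J Γ : Type*} [Group W] [MulAction W Γ] (X : ReflectionSystem W J Γ)

/-- The element spelled by a word. -/
def wprod (I : List J) : W := (I.map X.s).prod

/-- The least length of a word spelling `w`. -/
def length (w : W) : ℕ := sInf {n | ∃ I, X.wprod I = w ∧ I.length = n}

/-- The opposite root. -/
def neg (γ : Γ) : Γ := X.refl γ • γ

@[simp] lemma wprod_nil : X.wprod [] = 1 := rfl

@[simp] lemma wprod_cons (j : J) (I : List J) : X.wprod (j :: I) = X.s j * X.wprod I := by
  simp [wprod]

@[simp] lemma wprod_append (I I' : List J) : X.wprod (I ++ I') = X.wprod I * X.wprod I' := by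
  simp [wprod]

lemma length_wprod_le (I : List J) : X.length (X.wprod I) ≤ I.length :=
  Nat.sInf_le ⟨I, rfl, rfl⟩

lemma exists_reduced (w : W) : ∃ I, X.wprod I = w ∧ I.length = X.length w := by
  obtain ⟨I, hI⟩ := X.exists_word w
  exact Nat.sInf_mem (s := {n | ∃ I, X.wprod I = w ∧ I.length = n}) ⟨_, I, hI, rfl⟩

lemma eq_one_of_length_eq_zero {w : W} (h : X.length w = 0) : w = 1 := by
  obtain ⟨I, rfl, hI⟩ := X.exists_reduced w
  rw [h, List.length_eq_zero_iff] at hI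
  simp [hI]

lemma s_mul_self (j : J) : X.s j * X.s j = 1 := by
  rw [← X.refl_root, X.refl_mul_self]

lemma s_inv (j : J) : (X.s j)⁻¹ = X.s j := inv_eq_of_mul_eq_one_left (X.s_mul_self j)

lemma refl_inv (γ : Γ) : (X.refl γ)⁻¹ = X.refl γ := inv_eq_of_mul_eq_one_left (X.refl_mul_self γ)

lemma smul_neg (w : W) (γ : Γ) : w • X.neg γ = X.neg (w • γ) := by
  simp only [neg, X.refl_smul, mul_smul, inv_smul_smul]

lemma refl_neg (γ : Γ) : X.refl (X.neg γ) = X.refl γ := by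
  rw [neg, X.refl_smul, mul_inv_cancel_right]

lemma neg_neg (γ : Γ) : X.neg (X.neg γ) = γ := by
  rw [neg, X.refl_neg, neg, ← mul_smul, X.refl_mul_self, one_smul]

lemma pos_neg_iff (γ : Γ) : X.pos (X.neg γ) ↔ ¬ X.pos γ := X.pos_neg γ

/-- The strong exchange property, on the level of roots. -/
lemma exists_eq_smul_root (I : List J) {γ : Γ} (h : X.pos γ) (h' : ¬ X.pos ((X.wprod I)⁻¹ • γ)) :
    ∃ I₁ j I₂, I = I₁ ++ j :: I₂ ∧ γ = X.wprod I₁ • X.root j := by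
  induction I generalizing γ with
  | nil => simp [h] at h'
  | cons j I ih =>
    -- Follow `γ` while the letters of the word are applied one at a time: at the letter where the
    -- sign changes, the current root is simple.
    by_cases hj : X.pos (X.s j • γ)
    · obtain ⟨I₁, i, I₂, rfl, hγ⟩ := ih hj (by
        rwa [X.wprod_cons, mul_inv_rev, X.s_inv, mul_smul] at h')
      refine ⟨j :: I₁, i, I₂, rfl, ?_⟩
      rw [X.wprod_cons, mul_smul, ← hγ, ← mul_smul, X.s_mul_self, one_smul]
    · exact ⟨[], j, I, rfl, by simpa using X.eq_root j γ h hj⟩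

/-- If `γ` is the root attached to a letter of a reduced word of `w`, multiplying by `refl γ`
deletes that letter. -/
lemma length_refl_mul_lt {γ : Γ} {w : W} (h : X.pos γ) (h' : ¬ X.pos (w⁻¹ • γ)) :
    X.length (X.refl γ * w) < X.length w := by
  obtain ⟨I, rfl, hI⟩ := X.exists_reduced w
  obtain ⟨I₁, j, I₂, rfl, rfl⟩ := X.exists_eq_smul_root I h h'
  have : X.refl (X.wprod I₁ • X.root j) * X.wprod (I₁ ++ j :: I₂) = X.wprod (I₁ ++ I₂) := by
    rw [X.refl_smul, X.refl_root]
    simp only [wprod_append, wprod_cons, mul_assoc, inv_mul_cancel_left]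
    rw [← mul_assoc (X.s j), X.s_mul_self, one_mul]
  rw [this, ← hI]
  refine (X.length_wprod_le _).trans_lt ?_
  simp

/-- This is the previous lemma applied to `refl γ * w`, whose inverse makes `γ` negative. -/
lemma length_lt_refl_mul {γ : Γ} {w : W} (h : X.pos γ) (h' : X.pos (w⁻¹ • γ)) :
    X.length w < X.length (X.refl γ * w) := by
  have := X.length_refl_mul_lt (w := X.refl γ * w) h (by
    rw [mul_inv_rev, X.refl_inv, mul_smul]
    change ¬ X.pos (w⁻¹ • X.neg γ)
    rwa [X.smul_neg, X.pos_neg_iff, not_not])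
  rwa [← mul_assoc, X.refl_mul_self, one_mul] at this

/-- The reflection in a positive root makes that root negative, so the exchange property, applied to
any word spelling the reflection, exhibits the root as a translate of a simple one. Statements about
all roots thereby reduce to simple roots. -/
lemma exists_eq_smul (γ : Γ) : ∃ (w : W) (j : J), γ = w • X.root j := by
  have key : ∀ γ, X.pos γ → ∃ (w : W) (j : J), γ = w • X.root j := by
    intro γ h
    obtain ⟨I, hI⟩ := X.exists_word (X.refl γ)
    obtain ⟨I₁, j, -, -, h'⟩ := X.exists_eq_smul_root I h (by
      change X.wprod I = _ at hI
      rw [hI, X.refl_inv, X.pos_neg, not_not]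
      exact h)
    exact ⟨_, j, h'⟩
  by_cases h : X.pos γ
  · exact key γ h
  · obtain ⟨w, j, h'⟩ := key _ ((X.pos_neg γ).mpr h)
    refine ⟨w * X.s j, j, ?_⟩
    rw [mul_smul, ← X.refl_root]
    change γ = w • X.neg (X.root j)
    rw [X.smul_neg, ← h']
    exact (X.neg_neg γ).symm

lemma length_s_mul_lt_iff (j : J) (w : W) :
    X.length (X.s j * w) < X.length w ↔ ¬ X.pos (w⁻¹ • X.root j) := by
  rw [← X.refl_root]
  refine ⟨fun h h' => ?_, X.length_refl_mul_lt (X.pos_root j)⟩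
  exact absurd (X.length_lt_refl_mul (X.pos_root j) h') (by omega)

end ReflectionSystem
end AffineFADA
end

/-! ### Demazure elements over a reflection system -/

noncomputable section
namespace AffineFADA
namespace ReflectionSystem

open SkewMonoidAlgebra

section Demazure

variable {W J Γ : Type*} [Group W] [MulAction W Γ] (X : ReflectionSystem W J Γ)
  {B : Type*} [CommRing B] [MulSemiringAction W B] (c : J → B)

lemma length_s_mul_le (j : J) (w : W) : X.length (X.s j * w) ≤ X.length w + 1 := by
  obtain ⟨I, rfl, hI⟩ := X.exists_reduced w
  rw [← hI, ← X.wprod_cons]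
  exact X.length_wprod_le _

lemma length_le_length_s_mul (j : J) (w : W) : X.length w ≤ X.length (X.s j * w) + 1 := by
  simpa [← mul_assoc, X.s_mul_self] using X.length_s_mul_le j (X.s j * w)

/-- The element `c j (1 - η_{s j})` of a twisted group algebra. -/
def dem (j : J) : SkewMonoidAlgebra B W := c j • (1 - single (X.s j) 1)

/-- The product of the elements `dem j` along a word. -/
def demSeq (I : List J) : SkewMonoidAlgebra B W := (I.map (X.dem c)).prod

/-- The coefficient of `wprod I` in `demSeq I`, for `I` reduced. -/
def leadCoeff : List J → B
  | [] => 1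
  | j :: I => -(c j * X.s j • leadCoeff I)

@[simp] lemma demSeq_nil : X.demSeq c [] = 1 := rfl

@[simp] lemma demSeq_cons (j : J) (I : List J) :
    X.demSeq c (j :: I) = X.dem c j * X.demSeq c I := by
  simp [demSeq]

/-- Triangularity, leading coefficients and the residue condition are all read off from this
formula. -/
lemma coeff_dem_mul (j : J) (z : SkewMonoidAlgebra B W) (w : W) :
    (X.dem c j * z).coeff w = c j * (z.coeff w - X.s j • z.coeff (X.s j * w)) := by
  simp [dem, sub_mul, smul_mul_assoc, X.s_inv]

/-- Left multiplication by `dem j` adds to the support only translates by `s j`, which raises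
lengths by at most one. The word need not be reduced, hence the comparison with the length of the
word. -/
lemma eq_or_length_lt_of_coeff_ne_zero (I : List J) {w : W} (h : (X.demSeq c I).coeff w ≠ 0) :
    w = X.wprod I ∨ X.length w < I.length := by
  classical
  induction I generalizing w with
  | nil =>
    left
    by_contra hw
    exact h (by rw [demSeq_nil, coeff_one, Finsupp.single_apply]; exact if_neg (Ne.symm hw))
  | cons j I ih =>
    rw [demSeq_cons, coeff_dem_mul] at h
    by_cases h1 : (X.demSeq c I).coeff w = 0
    · have h2 : (X.demSeq c I).coeff (X.s j * w) ≠ 0 := by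
        rintro h2
        simp [h1, h2] at h
      rcases ih h2 with h3 | h3
      · left
        rw [X.wprod_cons, ← h3, ← mul_assoc, X.s_mul_self, one_mul]
      · right
        have := X.length_le_length_s_mul j w
        simp only [List.length_cons]
        omega
    · right
      simp only [List.length_cons]
      rcases ih h1 with h3 | h3
      · rw [h3]
        exact Nat.lt_succ_of_le (X.length_wprod_le I)
      · omega

lemma length_le_of_coeff_ne_zero (I : List J) {w : W} (h : (X.demSeq c I).coeff w ≠ 0) :
    X.length w ≤ I.length := by
  rcases X.eq_or_length_lt_of_coeff_ne_zero c I h with rfl | h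
  · exact X.length_wprod_le I
  · exact h.le

lemma reduced_of_cons {j : J} {I : List J} (h : (j :: I).length = X.length (X.wprod (j :: I))) :
    I.length = X.length (X.wprod I) := by
  refine le_antisymm ?_ (X.length_wprod_le I)
  have := X.length_s_mul_le j (X.wprod I)
  rw [X.wprod_cons, List.length_cons] at h
  omega

/-- For a reduced word the full product is too long to lie in the support of the tail, so only the
`s j`-translated term contributes. -/
lemma coeff_demSeq_wprod (I : List J) (h : I.length = X.length (X.wprod I)) :
    (X.demSeq c I).coeff (X.wprod I) = X.leadCoeff c I := by
  induction I with
  | nil => simp [leadCoeff]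
  | cons j I ih =>
    have h0 : (X.demSeq c I).coeff (X.wprod (j :: I)) = 0 := by
      by_contra h1
      have := X.length_le_of_coeff_ne_zero c I h1
      rw [← h, List.length_cons] at this
      omega
    rw [demSeq_cons, coeff_dem_mul, h0, X.wprod_cons, ← mul_assoc, X.s_mul_self, one_mul,
      ih (X.reduced_of_cons h), leadCoeff]
    ring

lemma isUnit_leadCoeff (hc : ∀ j, IsUnit (c j)) (I : List J) : IsUnit (X.leadCoeff c I) := by
  induction I with
  | nil => exact isUnit_one
  | cons j I ih =>
    exact ((hc j).mul (ih.map (MulSemiringAction.toRingHom W B (X.s j)))).neg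

/-! ### Change of coefficients in twisted group algebras -/

section Map

variable {B' : Type*} [CommRing B'] [MulSemiringAction W B']

/-- The homomorphism of twisted group algebras induced by an equivariant homomorphism of
coefficient rings. -/
def mapTwisted (f : B →+* B') (hf : ∀ (w : W) (p : B), f (w • p) = w • f p) :
    SkewMonoidAlgebra B W →+* SkewMonoidAlgebra B' W :=
  liftNCRingHom (singleOneRingHom.comp f) (of B' W) fun {x y} => by
    simp [singleOneRingHom, hf]

variable (f : B →+* B') (hf : ∀ (w : W) (p : B), f (w • p) = w • f p)

lemma mapTwisted_single (w : W) (p : B) : mapTwisted f hf (single w p) = single w (f p) := by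
  change liftNC _ _ _ = _
  rw [liftNC_single]
  simp [singleOneRingHom]

lemma mapTwisted_smul (p : B) (z : SkewMonoidAlgebra B W) :
    mapTwisted f hf (p • z) = f p • mapTwisted f hf z := by
  have h : ∀ (B : Type _) [CommRing B] [MulSemiringAction W B] (p : B) (z : SkewMonoidAlgebra B W),
      p • z = single 1 p * z := by
    intro B _ _ p z
    ext w
    simp
  rw [h, map_mul, mapTwisted_single]
  ext w
  simp

lemma mapTwisted_dem (j : J) : mapTwisted f hf (X.dem c j) = X.dem (fun i => f (c i)) j := by
  rw [dem, mapTwisted_smul, map_sub, map_one, mapTwisted_single, map_one, dem]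

lemma mapTwisted_demSeq (I : List J) :
    mapTwisted f hf (X.demSeq c I) = X.demSeq (fun i => f (c i)) I := by
  induction I with
  | nil => simp
  | cons j I ih => rw [demSeq_cons, map_mul, mapTwisted_dem, ih, demSeq_cons]

end Map

end Demazure

end ReflectionSystem
end AffineFADA
end

/-! ### Residue conditions -/

noncomputable section
namespace AffineFADA
namespace ReflectionSystem

open SkewMonoidAlgebra

variable {W J Γ : Type*} [Group W] [MulAction W Γ]

/-- An equivariant family `ξ` of elements of a ring `A` indexed by the roots, with the formal
properties of the elements `x_α` of a formal group algebra. -/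
structure RootFunction (X : ReflectionSystem W J Γ) (A : Type*) [CommRing A]
    [MulSemiringAction W A] where
  ξ : Γ → A
  smul_ξ : ∀ (w : W) γ, w • ξ γ = ξ (w • γ)
  ξ_ne_zero : ∀ γ, ξ γ ≠ 0
  mul_dvd_add : ∀ γ, ξ γ * ξ (X.neg γ) ∣ ξ γ + ξ (X.neg γ)
  dvd_sub : ∀ γ f, ξ γ ∣ f - X.refl γ • f
  coprime : ∀ β γ, β ≠ γ → β ≠ X.neg γ → ∀ f, ξ γ ∣ ξ β * f → ξ γ ∣ f

namespace RootFunction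

variable {X : ReflectionSystem W J Γ} {A : Type*} [CommRing A] [MulSemiringAction W A]
  (D : RootFunction X A)

lemma dvd_neg (γ : Γ) : D.ξ γ ∣ D.ξ (X.neg γ) :=
  (dvd_add_right dvd_rfl).mp ((dvd_mul_right _ _).trans (D.mul_dvd_add γ))

lemma neg_dvd (γ : Γ) : D.ξ (X.neg γ) ∣ D.ξ γ := by
  simpa only [X.neg_neg] using D.dvd_neg (X.neg γ)

lemma neg_dvd_iff (γ : Γ) (f : A) : D.ξ (X.neg γ) ∣ f ↔ D.ξ γ ∣ f :=
  ⟨(D.dvd_neg γ).trans, (D.neg_dvd γ).trans⟩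

lemma smul_dvd_iff (w : W) (γ : Γ) (f : A) : D.ξ (w • γ) ∣ w • f ↔ D.ξ γ ∣ f := by
  have key : ∀ (w : W) (γ : Γ) (f : A), D.ξ γ ∣ f → D.ξ (w • γ) ∣ w • f := by
    rintro w γ _ ⟨g, rfl⟩
    rw [smul_mul', D.smul_ξ]
    exact dvd_mul_right _ _
  refine ⟨fun h => ?_, key w γ f⟩
  simpa using key w⁻¹ _ _ h

/-- The elements that are not zero divisors modulo `ξ γ`. -/
def coprimeTo (γ : Γ) : Submonoid A where
  carrier := {h | ∀ f, D.ξ γ ∣ h * f → D.ξ γ ∣ f}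
  one_mem' f hf := by simpa using hf
  mul_mem' {a b} ha hb f hf := hb f (ha _ (by rwa [← mul_assoc]))

lemma coprimeTo_neg (γ : Γ) : D.coprimeTo (X.neg γ) = D.coprimeTo γ := by
  ext h
  change (∀ f, _ → _) ↔ (∀ f, _ → _)
  simp only [D.neg_dvd_iff]

lemma smul_mem_coprimeTo {γ : Γ} {h : A} (hh : h ∈ D.coprimeTo γ) (w : W) :
    w • h ∈ D.coprimeTo (w • γ) := by
  intro f hf
  have : w • h * f = w • (h * (w⁻¹ • f)) := by simp
  rw [this, D.smul_dvd_iff] at hf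
  simpa using (D.smul_dvd_iff w γ _).mpr (hh _ hf)

variable (B : Type*) [CommRing B] [Algebra A B]

/-- The elements of the localization whose denominators are prime to `ξ γ`. -/
def integralAt (γ : Γ) : Subring B where
  carrier := {p | ∃ h ∈ D.coprimeTo γ, ∃ g, algebraMap A B h * p = algebraMap A B g}
  one_mem' := ⟨1, one_mem _, 1, by simp⟩
  zero_mem' := ⟨1, one_mem _, 0, by simp⟩
  mul_mem' := by
    rintro p q ⟨h, hh, g, hg⟩ ⟨h', hh', g', hg'⟩
    exact ⟨h * h', mul_mem hh hh', g * g', by rw [map_mul, map_mul, ← hg, ← hg']; ring⟩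
  add_mem' := by
    rintro p q ⟨h, hh, g, hg⟩ ⟨h', hh', g', hg'⟩
    exact ⟨h * h', mul_mem hh hh', h' * g + h * g', by
      simp only [map_mul, map_add, ← hg, ← hg']; ring⟩
  neg_mem' := by
    rintro p ⟨h, hh, g, hg⟩
    exact ⟨h, hh, -g, by rw [map_neg, ← hg]; ring⟩

lemma algebraMap_mem_integralAt (γ : Γ) (a : A) : algebraMap A B a ∈ D.integralAt B γ :=
  ⟨1, one_mem _, a, by simp⟩

lemma integralAt_neg (γ : Γ) : D.integralAt B (X.neg γ) = D.integralAt B γ := by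
  ext p
  change (∃ h ∈ D.coprimeTo (X.neg γ), _) ↔ ∃ h ∈ D.coprimeTo γ, _
  rw [coprimeTo_neg]

/-- The multiplicative set generated by the `ξ γ`. -/
def denominators : Submonoid A := Submonoid.closure (Set.range D.ξ)

lemma ξ_mem_denominators (γ : Γ) : D.ξ γ ∈ D.denominators := Submonoid.subset_closure ⟨γ, rfl⟩

variable [IsLocalization D.denominators B]

/-- The inverse of `ξ γ`. -/
def inv (γ : Γ) : B := IsLocalization.mk' B 1 ⟨D.ξ γ, D.ξ_mem_denominators γ⟩

@[simp] lemma mul_inv (γ : Γ) : algebraMap A B (D.ξ γ) * D.inv B γ = 1 := by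
  rw [inv, mul_comm, IsLocalization.mk'_spec]
  simp

variable {B} in
lemma ξ_mul_cancel {γ : Γ} {p q : B}
    (h : algebraMap A B (D.ξ γ) * p = algebraMap A B (D.ξ γ) * q) : p = q := by
  have := congrArg (D.inv B γ * ·) h
  beta_reduce at this
  rw [← mul_assoc, ← mul_assoc, mul_comm (D.inv B γ), D.mul_inv, one_mul, one_mul] at this
  exact this

lemma inv_mem_integralAt {β γ : Γ} (h : β ≠ γ) (h' : β ≠ X.neg γ) :
    D.inv B β ∈ D.integralAt B γ :=
  ⟨D.ξ β, D.coprime β γ h h', 1, by simp⟩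

/-- The sum is `(ξ γ + ξ (-γ)) / (ξ γ * ξ (-γ))`. Hence, up to integral elements, the reflection in
`γ` changes the sign of `1 / ξ γ`. -/
lemma exists_inv_add_inv (γ : Γ) : ∃ a, D.inv B γ + D.inv B (X.neg γ) = algebraMap A B a := by
  obtain ⟨a, ha⟩ := D.mul_dvd_add γ
  refine ⟨a, D.ξ_mul_cancel (γ := γ) (D.ξ_mul_cancel (γ := X.neg γ) ?_)⟩
  have h := congrArg (algebraMap A B) ha
  simp only [map_mul, map_add] at h
  calc _ = (algebraMap A B (D.ξ γ) * D.inv B γ) * algebraMap A B (D.ξ (X.neg γ))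
        + (algebraMap A B (D.ξ (X.neg γ)) * D.inv B (X.neg γ)) * algebraMap A B (D.ξ γ) := by ring
    _ = _ := by rw [D.mul_inv, D.mul_inv, one_mul, one_mul, add_comm, h]; ring

lemma algebraMap_injective [IsDomain A] (D : RootFunction X A) [IsLocalization D.denominators B] :
    Function.Injective (algebraMap A B) := by
  refine IsLocalization.injective B (M := D.denominators) ?_
  rw [denominators, Submonoid.closure_le]
  rintro _ ⟨γ, rfl⟩
  exact mem_nonZeroDivisors_of_ne_zero (D.ξ_ne_zero γ)

variable {B} in
-- This plays the role of writing a normal ring as an intersection of localizations, but needs no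
-- factoriality: the denominators are cancelled one root at a time.
lemma mem_range_of_forall_integralAt [IsDomain A] {q : B} (hq : ∀ γ, q ∈ D.integralAt B γ) :
    ∃ a, algebraMap A B a = q := by
  -- The induction is on the denominator with `q` arbitrary, because for a product `m * m'` the
  -- induction hypothesis for `m` is used at `m' q`.
  have key : ∀ m ∈ D.denominators, ∀ q : B, (∀ γ, q ∈ D.integralAt B γ) →
      (∃ f, algebraMap A B f = algebraMap A B m * q) → ∃ a, algebraMap A B a = q := by
    intro m hm
    induction hm using Submonoid.closure_induction with
    | mem m hm =>
      obtain ⟨β, rfl⟩ := hm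
      rintro q hq ⟨f, hf⟩
      obtain ⟨h, hh, g, hg⟩ := hq β
      have h1 : h * f = D.ξ β * g := algebraMap_injective B D (by
        rw [map_mul, map_mul, hf, ← hg]; ring)
      obtain ⟨f', rfl⟩ := hh f ⟨g, h1⟩
      exact ⟨f', D.ξ_mul_cancel (γ := β) (by rw [← hf, map_mul])⟩
    | one =>
      rintro q - ⟨f, hf⟩
      exact ⟨f, by simpa using hf⟩
    | mul m m' _ _ ih ih' =>
      rintro q hq ⟨f, hf⟩
      refine ih' q hq (ih _ (fun γ => mul_mem (D.algebraMap_mem_integralAt B γ m') (hq γ))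
        ⟨f, by rw [hf, map_mul, mul_assoc]⟩)
  obtain ⟨⟨f, m⟩, h⟩ := IsLocalization.surj D.denominators q
  exact key m m.2 q hq ⟨f, by rw [← h, mul_comm]⟩

variable [MulSemiringAction W B] [SMulDistribClass W A B]

omit [IsLocalization D.denominators B] in
lemma smul_algebraMap (w : W) (a : A) : w • algebraMap A B a = algebraMap A B (w • a) := by
  rw [Algebra.algebraMap_eq_smul_one, Algebra.algebraMap_eq_smul_one, smul_distrib_smul, smul_one]

lemma smul_inv (w : W) (γ : Γ) : w • D.inv B γ = D.inv B (w • γ) := by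
  refine D.ξ_mul_cancel (γ := w • γ) ?_
  rw [D.mul_inv, ← D.smul_ξ, ← smul_algebraMap, ← smul_mul', D.mul_inv, smul_one]

variable {B}

omit [IsLocalization D.denominators B] in
lemma smul_mem_integralAt {γ : Γ} {p : B} (hp : p ∈ D.integralAt B γ) (w : W) :
    w • p ∈ D.integralAt B (w • γ) := by
  obtain ⟨h, hh, g, hg⟩ := hp
  refine ⟨w • h, D.smul_mem_coprimeTo hh w, w • g, ?_⟩
  rw [← smul_algebraMap, ← smul_algebraMap, ← hg, smul_mul']

omit [IsLocalization D.denominators B] in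
lemma refl_smul_mem_integralAt {γ : Γ} {p : B} (hp : p ∈ D.integralAt B γ) :
    X.refl γ • p ∈ D.integralAt B γ := by
  rw [← D.integralAt_neg]
  exact D.smul_mem_integralAt hp _

/-- Divided differences exist on `A`, and the quotient rule extends them to fractions whose
denominators are prime to `ξ γ`. -/
lemma inv_mul_sub_mem_integralAt {γ : Γ} {p : B} (hp : p ∈ D.integralAt B γ) :
    D.inv B γ * (p - X.refl γ • p) ∈ D.integralAt B γ := by
  obtain ⟨h, hh, g, hg⟩ := hp
  obtain ⟨u, hu⟩ := D.dvd_sub γ h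
  obtain ⟨v, hv⟩ := D.dvd_sub γ g
  have hh' : X.refl γ • h ∈ D.coprimeTo γ := by
    rw [← coprimeTo_neg]
    exact D.smul_mem_coprimeTo hh _
  -- Quotient rule: with `u`, `v` the divided differences of `h`, `g`, that of `g / h` is `(v h - g
  -- u) / (h * s_γ h)`.
  refine ⟨h * X.refl γ • h, mul_mem hh hh', v * h - g * u, D.ξ_mul_cancel (γ := γ) ?_⟩
  have hg' := congrArg (X.refl γ • ·) hg
  simp only [smul_mul', smul_algebraMap] at hg'
  have hu' := congrArg (algebraMap A B) hu
  have hv' := congrArg (algebraMap A B) hv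
  simp only [map_sub, map_mul] at hu' hv' ⊢
  calc _ = (algebraMap A B (D.ξ γ) * D.inv B γ) *
        ((algebraMap A B h * p) * algebraMap A B (X.refl γ • h)
        - algebraMap A B h * (algebraMap A B (X.refl γ • h) * X.refl γ • p)) := by ring
    _ = _ := by
      rw [D.mul_inv, hg, hg']
      linear_combination algebraMap A B h * hv' - algebraMap A B g * hu'

/-- The residue condition along `γ` for an element of the twisted group algebra: poles along `γ`
are simple, and the residues of the coefficients of `w` and `s_γ w` are opposite. -/
def Residue (γ : Γ) (z : SkewMonoidAlgebra B W) : Prop :=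
  ∀ w, algebraMap A B (D.ξ γ) * z.coeff w ∈ D.integralAt B γ ∧
    z.coeff w + z.coeff (X.refl γ * w) ∈ D.integralAt B γ

variable {D}

omit [IsLocalization D.denominators B] [MulSemiringAction W B] [SMulDistribClass W A B] in
lemma Residue.sub {γ : Γ} {z z' : SkewMonoidAlgebra B W} (h : D.Residue γ z)
    (h' : D.Residue γ z') : D.Residue γ (z - z') := fun w => by
  constructor
  · rw [coeff_sub, Finsupp.sub_apply, mul_sub]
    exact sub_mem (h w).1 (h' w).1
  · simp only [coeff_sub, Finsupp.sub_apply]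
    convert! sub_mem (h w).2 (h' w).2 using 1
    ring

omit [IsLocalization D.denominators B] [MulSemiringAction W B] [SMulDistribClass W A B] in
lemma Residue.smul {γ : Γ} {z : SkewMonoidAlgebra B W} (h : D.Residue γ z) {p : B}
    (hp : p ∈ D.integralAt B γ) : D.Residue γ (p • z) := fun w => by
  simp only [coeff_smul, Finsupp.smul_apply, smul_eq_mul]
  constructor
  · rw [mul_left_comm]
    exact mul_mem hp (h w).1
  · rw [← mul_add]
    exact mul_mem hp (h w).2

variable (D) in
omit [IsLocalization D.denominators B] [SMulDistribClass W A B] [MulSemiringAction W B] in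
lemma residue_one (γ : Γ) : D.Residue γ (1 : SkewMonoidAlgebra B W) := by
  classical
  have h : ∀ w, (1 : SkewMonoidAlgebra B W).coeff w ∈ D.integralAt B γ := fun w => by
    rw [coeff_one, Finsupp.single_apply]
    split_ifs
    · exact one_mem _
    · exact zero_mem _
  exact fun w => ⟨mul_mem (D.algebraMap_mem_integralAt B γ _) (h w), add_mem (h _) (h _)⟩

omit [IsLocalization D.denominators B] [MulSemiringAction W B] [SMulDistribClass W A B] in
lemma Residue.neg {γ : Γ} {z : SkewMonoidAlgebra B W} (h : D.Residue γ z) :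
    D.Residue (X.neg γ) z := fun w => by
  rw [D.integralAt_neg, X.refl_neg]
  refine ⟨?_, (h w).2⟩
  obtain ⟨a, ha⟩ := D.dvd_neg γ
  rw [ha, map_mul, mul_right_comm]
  exact mul_mem (h w).1 (D.algebraMap_mem_integralAt B γ a)

omit [IsLocalization D.denominators B] in
lemma Residue.single_mul {γ : Γ} {z : SkewMonoidAlgebra B W} (h : D.Residue γ z) (v : W) :
    D.Residue (v • γ) (single v 1 * z) := fun w => by
  simp only [coeff_single_mul, one_mul]
  constructor
  · rw [← D.smul_ξ, ← smul_algebraMap, ← smul_mul']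
    exact D.smul_mem_integralAt (h _).1 v
  · rw [X.refl_smul, mul_assoc, mul_assoc, inv_mul_cancel_left, ← smul_add]
    exact D.smul_mem_integralAt (h _).2 v

/-- Division by `ξ` creates no double pole: the residues of the coefficients at `w` and `s_j w` are
opposite, and `s_j` reverses the sign of a residue, so the poles cancel in the difference before the
division. -/
lemma residue_dem_mul_root {j : J} {z : SkewMonoidAlgebra B W} (h : D.Residue (X.root j) z) :
    D.Residue (X.root j) (X.dem (fun j => D.inv B (X.root j)) j * z) := fun w => by
  have hs : X.s j * (X.s j * w) = w := by rw [← mul_assoc, X.s_mul_self, one_mul]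
  obtain ⟨c, hc⟩ := D.exists_inv_add_inv B (X.root j)
  simp only [coeff_dem_mul, X.refl_root, hs]
  constructor
  -- Write the coefficient at `s_j w` as `q = a / ξ` with `a` integral. Then `z_w - s_j q` equals
  -- `(z_w + q) - (a - s_j a) / ξ - (1/ξ + 1/ξ_-) s_j a`, where `ξ_-` belongs to the opposite root;
  -- every term is integral.
  · have h1 := (h w).2
    have h2 := (h (X.s j * w)).1
    rw [X.refl_root] at h1
    set q := z.coeff (X.s j * w)
    set a := algebraMap A B (D.ξ (X.root j)) * q with ha
    have hq : q = D.inv B (X.root j) * a := by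
      rw [ha, ← mul_assoc, mul_comm (D.inv B _), D.mul_inv, one_mul]
    have hq' : X.s j • q = D.inv B (X.neg (X.root j)) * X.s j • a := by
      rw [hq, smul_mul', D.smul_inv, neg, X.refl_root]
    have h3 := D.inv_mul_sub_mem_integralAt h2
    have h4 := D.refl_smul_mem_integralAt h2
    rw [X.refl_root] at h3 h4
    have h5 := sub_mem h1 (add_mem h3 (mul_mem (hc ▸ D.algebraMap_mem_integralAt B _ c) h4))
    convert! h5 using 1
    rw [← mul_assoc, D.mul_inv]
    clear_value a q
    linear_combination -hq - hq'
  -- The sum of the two new coefficients is the divided difference of the integral sum of the old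
  -- ones.
  · have h3 := D.inv_mul_sub_mem_integralAt (h w).2
    rw [X.refl_root, smul_add] at h3
    convert! h3 using 1
    ring

/-- Along a root other than `±α_j` the factor `1 / ξ` is integral, and the condition for `η_{s_j} z`
along `γ` is that for `z` along `s_j γ`. This is why the conditions along all roots are carried
together. -/
lemma residue_dem_mul (j : J) {z : SkewMonoidAlgebra B W} (h : ∀ γ, D.Residue γ z) (γ : Γ) :
    D.Residue γ (X.dem (fun j => D.inv B (X.root j)) j * z) := by
  by_cases h1 : X.root j = γ
  · subst h1
    exact residue_dem_mul_root (h _)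
  by_cases h2 : X.root j = X.neg γ
  · rw [← X.neg_neg γ, ← h2]
    exact (residue_dem_mul_root (h _)).neg
  rw [dem, smul_mul_assoc, sub_mul, one_mul]
  refine ((h γ).sub ?_).smul (D.inv_mem_integralAt B h1 h2)
  simpa using (h ((X.s j)⁻¹ • γ)).single_mul (X.s j)

lemma residue_demSeq (I : List J) (γ : Γ) :
    D.Residue γ (X.demSeq (fun j => D.inv B (X.root j)) I) := by
  induction I generalizing γ with
  | nil => exact D.residue_one γ
  | cons j I ih =>
    rw [demSeq_cons]
    exact residue_dem_mul j ih γ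

end RootFunction

end ReflectionSystem
end AffineFADA
end

/-! ### The residue conditions characterize the span -/

noncomputable section
namespace AffineFADA
namespace ReflectionSystem

open SkewMonoidAlgebra

variable {W J Γ : Type*} [Group W] [MulAction W Γ]

/-- The roots `s_{i₁} ⋯ s_{iₖ₋₁} α_{iₖ}` attached to a word. -/
def rootSeq (X : ReflectionSystem W J Γ) : List J → List Γ
  | [] => []
  | j :: I => X.root j :: (X.rootSeq I).map (X.s j • ·)

lemma smul_root_mem_rootSeq (X : ReflectionSystem W J Γ) (I₁ : List J) (j : J) (I₂ : List J) :
    X.wprod I₁ • X.root j ∈ X.rootSeq (I₁ ++ j :: I₂) := by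
  induction I₁ with
  | nil => simp [rootSeq]
  | cons i I₁ ih =>
    rw [List.cons_append, rootSeq, List.mem_cons, wprod_cons, mul_smul]
    exact Or.inr (List.mem_map_of_mem ih)

namespace RootFunction

variable {X : ReflectionSystem W J Γ} {A : Type*} [CommRing A] [MulSemiringAction W A]
  (D : RootFunction X A)
  (B : Type*) [CommRing B] [Algebra A B] [IsLocalization D.denominators B]
  [MulSemiringAction W B] [SMulDistribClass W A B]

/-- So, up to sign, the leading coefficient is the inverse of the product of the `ξ` over the roots
attached to the word. -/
lemma leadCoeff_mul_prod (I : List J) :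
    X.leadCoeff (fun j => D.inv B (X.root j)) I *
      algebraMap A B (((X.rootSeq I).map D.ξ).prod) = (-1) ^ I.length := by
  induction I with
  | nil => simp [leadCoeff, rootSeq]
  | cons j I ih =>
    have h := congrArg (X.s j • ·) ih
    simp only [smul_mul', smul_algebraMap, smul_pow', _root_.smul_neg, smul_one] at h
    have h' : ((X.rootSeq (j :: I)).map D.ξ).prod =
        D.ξ (X.root j) * X.s j • ((X.rootSeq I).map D.ξ).prod := by
      rw [rootSeq, List.map_cons, List.prod_cons, List.map_map, List.smul_prod', List.map_map]
      congr 3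
      ext γ
      exact (D.smul_ξ _ _).symm
    rw [h', leadCoeff, List.length_cons, pow_succ, ← h, map_mul]
    linear_combination - (X.s j • X.leadCoeff (fun j => D.inv B (X.root j)) I *
      algebraMap A B (X.s j • ((X.rootSeq I).map D.ξ).prod)) * D.mul_inv B (X.root j)

variable {D B} [IsDomain A]

/-- Let `w` be the product of `I`. The product of the `ξ` over `rootSeq` clears all poles of the
coefficient at `w`. Along a root of `rootSeq` the pole is simple. Along any other positive root `γ`,
the element `s_γ w` is longer than `w`, hence outside the support, and the residue condition leaves
no pole at all. -/
lemma exists_coeff_eq_mul_leadCoeff {z : SkewMonoidAlgebra B W} (hz : ∀ γ, D.Residue γ z)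
    {I : List J} (hI : I.length = X.length (X.wprod I))
    (hlen : ∀ v, z.coeff v ≠ 0 → X.length v ≤ I.length) :
    ∃ a : A, z.coeff (X.wprod I) =
      algebraMap A B a * X.leadCoeff (fun j => D.inv B (X.root j)) I := by
  have key : ∀ γ, X.pos γ → z.coeff (X.wprod I) * algebraMap A B (((X.rootSeq I).map D.ξ).prod) ∈
      D.integralAt B γ := by
    intro γ hγ
    by_cases h : γ ∈ X.rootSeq I
    · obtain ⟨f, hf⟩ := List.dvd_prod (List.mem_map_of_mem (f := D.ξ) h)
      rw [hf, map_mul, ← mul_assoc, mul_comm (z.coeff _)]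
      exact mul_mem (hz γ _).1 (D.algebraMap_mem_integralAt B γ f)
    · have hpos : X.pos ((X.wprod I)⁻¹ • γ) := by
        by_contra hn
        obtain ⟨I₁, j, I₂, rfl, rfl⟩ := X.exists_eq_smul_root I hγ hn
        exact h (X.smul_root_mem_rootSeq I₁ j I₂)
      have h0 : z.coeff (X.refl γ * X.wprod I) = 0 := by
        by_contra hn
        have h1 := hlen _ hn
        have h2 := X.length_lt_refl_mul hγ hpos
        omega
      have h3 := (hz γ (X.wprod I)).2
      rw [h0, add_zero] at h3
      exact mul_mem h3 (D.algebraMap_mem_integralAt B γ _)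
  obtain ⟨a, ha⟩ := D.mem_range_of_forall_integralAt (fun γ => by
    by_cases h : X.pos γ
    · exact key γ h
    · rw [← D.integralAt_neg]
      exact key _ ((X.pos_neg_iff γ).mpr h))
  -- The sign is the one in `leadCoeff_mul_prod`; it is its own inverse.
  refine ⟨(-1) ^ I.length * a, ?_⟩
  have h1 := D.leadCoeff_mul_prod B I
  have h2 : ((-1 : B) ^ I.length) * (-1) ^ I.length = 1 := by
    rw [← mul_pow]
    simp
  rw [map_mul, ha, map_pow, map_neg, map_one]
  linear_combination -(z.coeff (X.wprod I)) * h2 - (-1) ^ I.length * z.coeff (X.wprod I) * h1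

/-- The elements of the twisted group algebra subject to the residue conditions are linear
combinations, with coefficients in `A`, of the products of Demazure elements along any choice of
reduced words. -/
theorem mem_span_of_residue {I : W → List J} (hI : ∀ w, X.wprod (I w) = w)
    (hI' : ∀ w, (I w).length = X.length w) {z : SkewMonoidAlgebra B W}
    (hz : ∀ γ, D.Residue γ z) :
    z ∈ Submodule.span A (Set.range fun w =>
      X.demSeq (fun j => D.inv B (X.root j)) (I w)) := by
  classical
  -- Induction on a strict bound for the lengths in the support: subtracting suitable multiples of
  -- the `X_{I_w}` removes the top layer and keeps the residue conditions.
  have key : ∀ n (z : SkewMonoidAlgebra B W), (∀ γ, D.Residue γ z) →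
      (∀ w, z.coeff w ≠ 0 → X.length w < n) →
      z ∈ Submodule.span A (Set.range fun w =>
        X.demSeq (fun j => D.inv B (X.root j)) (I w)) := by
    intro n
    induction n with
    | zero =>
      intro z _ h
      have : z = 0 := by
        ext w
        by_contra hw
        exact absurd (h w hw) (by omega)
      rw [this]
      exact zero_mem _
    | succ n ih =>
      intro z hz h
      have h1 : ∀ w, ∃ a : A, X.length w = n → z.coeff w =
          algebraMap A B a * X.leadCoeff (fun j => D.inv B (X.root j)) (I w) := by
        intro w
        by_cases hw : X.length w = n
        · obtain ⟨a, ha⟩ := exists_coeff_eq_mul_leadCoeff hz (I := I w)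
            (by rw [hI, hI']) (fun v hv => by rw [hI', hw]; exact Nat.lt_succ_iff.mp (h v hv))
          exact ⟨a, fun _ => by rw [← ha, hI]⟩
        · exact ⟨0, fun h => absurd h hw⟩
      choose a ha using h1
      set T := z.support.filter fun w => X.length w = n with hT
      set y := ∑ w ∈ T, a w • X.demSeq (fun j => D.inv B (X.root j)) (I w) with hy
      have hys : y ∈ Submodule.span A (Set.range fun w =>
          X.demSeq (fun j => D.inv B (X.root j)) (I w)) :=
        Submodule.sum_mem _ fun w _ => Submodule.smul_mem _ _ (Submodule.subset_span ⟨w, rfl⟩)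
      have hyr : ∀ γ, D.Residue γ (z - y) := by
        intro γ
        rw [hy]
        clear_value T
        clear hy hys hT
        induction T using Finset.induction_on with
        | empty => simpa using hz γ
        | insert w T hw ih =>
          rw [Finset.sum_insert hw, add_comm, ← sub_sub]
          refine ih.sub ?_
          rw [← algebraMap_smul B (a w)]
          exact (residue_demSeq _ γ).smul (D.algebraMap_mem_integralAt B γ _)
      have hyc : ∀ v, n ≤ X.length v → (z - y).coeff v = 0 := by
        intro v hv
        have h2 : ∀ w ∈ T, w ≠ v →
            (a w • X.demSeq (fun j => D.inv B (X.root j)) (I w)).coeff v = 0 := by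
          intro w hw hwv
          rw [coeff_smul, Finsupp.smul_apply]
          by_contra h3
          have hwn : X.length w = n := (Finset.mem_filter.mp hw).2
          -- Among elements of length at least `n`, the support of `X_{I_w}` with `w` of length `n`
          -- contains at most `w`, so the corrections in the top layer do not interfere.
          rcases X.eq_or_length_lt_of_coeff_ne_zero _ (I w) (right_ne_zero_of_smul h3) with h4 | h4
          · exact hwv (by rw [h4, hI])
          · rw [hI', hwn] at h4
            omega
        have h5 : y.coeff v = ∑ w ∈ T,
            (a w • X.demSeq (fun j => D.inv B (X.root j)) (I w)).coeff v := by
          rw [hy]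
          change coeffAddEquiv _ v = _
          rw [_root_.map_sum, Finsupp.finsetSum_apply]
          rfl
        rw [coeff_sub, Finsupp.sub_apply, h5]
        by_cases hvT : v ∈ T
        · have hvn : X.length v = n := (Finset.mem_filter.mp hvT).2
          rw [Finset.sum_eq_single_of_mem v hvT fun w hw => h2 w hw, coeff_smul,
            Finsupp.smul_apply]
          have h6 := X.coeff_demSeq_wprod (fun j => D.inv B (X.root j)) (I v) (by rw [hI, hI'])
          rw [hI] at h6
          rw [h6, ha v hvn, Algebra.smul_def, sub_self]
        · rw [Finset.sum_eq_zero fun w hw => h2 w hw (fun h => hvT (h ▸ hw)), sub_zero]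
          by_contra h3
          have h4 := h v h3
          exact hvT (Finset.mem_filter.mpr ⟨mem_support_iff.mpr h3, by omega⟩)
      have := ih (z - y) hyr fun w hw => by
        by_contra h3
        exact hw (hyc w (by omega))
      simpa using add_mem this hys
  refine key (z.support.sup X.length + 1) z hz fun w hw => Nat.lt_succ_of_le ?_
  exact Finset.le_sup (f := X.length) (mem_support_iff.mpr hw)

end RootFunction

end ReflectionSystem
end AffineFADA
end

/-! ### The affine Weyl group as a reflection system -/

noncomputable section
namespace AffineFADA

open RootPairing

section Affine

variable {ι L N : Type*} [AddCommGroup L] [AddCommGroup N] (P : RootPairing ι ℤ L N)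

/-- The translation part of an element of the affine Weyl group. -/
def transl {P : RootPairing ι ℤ L N} (w : AffineWeyl P) : N := w.left.toAdd

/-- The action of the Weyl group on the cocharacter lattice, in additive notation. -/
def coact (v : P.weylGroup) (l : N) : N := (cocharAction P v (Multiplicative.ofAdd l)).toAdd

lemma coact_eq (v : P.weylGroup) (l : N) :
    coact P v l = ((v⁻¹ : P.weylGroup) : P.Aut).coweightMap l := rfl

variable {P} in
lemma transl_mul (w w' : AffineWeyl P) :
    transl (w * w') = transl w + coact P w.right (transl w') := rfl

variable {P} in
@[simp] lemma transl_one : transl (1 : AffineWeyl P) = 0 := rfl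

lemma toLinearMap_smul (g : P.Aut) (x : L) (y : N) :
    P.toLinearMap (g • x) y = P.toLinearMap x (g.coweightMap y) :=
  LinearMap.congr_fun (Hom.weight_coweight_transpose_apply P P y g.toHom) x

/-- Invariance of the pairing under the Weyl group is what makes the formulas on affine roots and on
the affine root lattice into actions. -/
lemma toLinearMap_smul_coact (v : P.weylGroup) (x : L) (y : N) :
    P.toLinearMap (v • x) (coact P v y) = P.toLinearMap x y := by
  rw [coact_eq, ← toLinearMap_smul]
  change P.toLinearMap ((v⁻¹ : P.weylGroup) • v • x) y = _
  rw [inv_smul_smul]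

lemma coact_coroot (v : P.weylGroup) (i : ι) :
    coact P v (P.coroot i) = P.coroot (P.weylGroupToPerm v i) := by
  rw [coact_eq, Hom.coroot_coweightMap_apply]
  rfl

lemma coact_map_zsmul (v : P.weylGroup) (m : ℤ) (l : N) :
    coact P v (m • l) = m • coact P v l := by
  rw [coact_eq, coact_eq, map_zsmul]

lemma coact_ofIdx (i : ι) (l : N) :
    coact P (weylGroup.ofIdx P i) l = l - P.toLinearMap (P.root i) l • P.coroot i := by
  rw [coact_eq]
  change ((RootPairing.Equiv.reflection P i)⁻¹ : P.Aut).coweightMap l = _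
  rw [Equiv.reflection_inv]
  change P.coreflection i l = _
  rw [coreflection_apply]

lemma ofIdx_smul_eq (i : ι) (x : L) :
    weylGroup.ofIdx P i • x = x - P.toLinearMap x (P.coroot i) • P.root i := by
  rw [weylGroup.ofIdx_smul, Equiv.reflection_smul, reflection_apply]
  rfl

lemma weylGroup_ext {v v' : P.weylGroup} (h : ∀ x : L, v • x = v' • x) : v = v' := by
  refine Subtype.ext (Equiv.weightHom_injective P (LinearEquiv.ext fun x => h x))

lemma ofIdx_weylGroupToPerm (v : P.weylGroup) (i : ι) :
    weylGroup.ofIdx P (P.weylGroupToPerm v i) = v * weylGroup.ofIdx P i * v⁻¹ := by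
  refine weylGroup_ext P fun x => ?_
  obtain ⟨y, rfl⟩ : ∃ y, v • y = x := ⟨v⁻¹ • x, smul_inv_smul v x⟩
  rw [mul_smul, mul_smul, inv_smul_smul, ofIdx_smul_eq, ofIdx_smul_eq, smul_sub,
    ← coact_coroot, toLinearMap_smul_coact, ← weylGroup_apply_root]
  congr 1
  exact (map_zsmul (DistribSMul.toAddMonoidHom L v) _ _).symm

lemma ofIdx_mul_self (i : ι) : weylGroup.ofIdx P i * weylGroup.ofIdx P i = 1 := by
  refine weylGroup_ext P fun x => ?_
  rw [mul_smul, one_smul, weylGroup.ofIdx_smul, weylGroup.ofIdx_smul, Equiv.reflection_smul,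
    Equiv.reflection_smul, reflection_same]

lemma weylGroupToPerm_ofIdx (i j : ι) :
    P.weylGroupToPerm (weylGroup.ofIdx P i) j = P.reflectionPerm i j := rfl

/-- The affine roots `α + m δ`. -/
def AffineRoot (_ : RootPairing ι ℤ L N) : Type _ := ι × ℤ

variable {P} in
/-- The action of the affine Weyl group on affine roots:
`(t_λ w)(α + m δ) = w(α) + (m - ⟨w(α), λ⟩) δ`. -/
instance affineRootAction : MulAction (AffineWeyl P) (AffineRoot P) where
  smul w γ := (P.weylGroupToPerm w.right γ.1,
    γ.2 - P.toLinearMap (P.root (P.weylGroupToPerm w.right γ.1)) (transl w))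
  one_smul γ := by
    refine Prod.ext ?_ ?_
    · change P.weylGroupToPerm 1 γ.1 = _
      simp
    · change γ.2 - P.toLinearMap _ (0 : N) = γ.2
      simp
  mul_smul w w' γ := by
    have h : P.weylGroupToPerm (w * w').right γ.1 =
        P.weylGroupToPerm w.right (P.weylGroupToPerm w'.right γ.1) := by
      rw [SemidirectProduct.mul_right, map_mul]
      rfl
    refine Prod.ext h ?_
    change γ.2 - P.toLinearMap (P.root (P.weylGroupToPerm (w * w').right γ.1)) (transl (w * w')) =
      γ.2 - P.toLinearMap (P.root (P.weylGroupToPerm w'.right γ.1)) (transl w') -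
      P.toLinearMap (P.root (P.weylGroupToPerm w.right (P.weylGroupToPerm w'.right γ.1)))
        (transl w)
    rw [h, transl_mul, map_add, ← weylGroup_apply_root P w.right, toLinearMap_smul_coact]
    ring

variable {P}

lemma affine_smul_fst (w : AffineWeyl P) (γ : AffineRoot P) :
    (w • γ).1 = P.weylGroupToPerm w.right γ.1 := rfl

lemma affine_smul_snd (w : AffineWeyl P) (γ : AffineRoot P) :
    (w • γ).2 = γ.2 - P.toLinearMap (P.root (P.weylGroupToPerm w.right γ.1)) (transl w) := rfl

/-- The reflection `t_{-m α^∨} s_α` in the affine root `α + m δ`. -/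
def affineRefl (γ : AffineRoot P) : AffineWeyl P :=
  translation P (-γ.2 • P.coroot γ.1) * finiteWeyl P (weylGroup.ofIdx P γ.1)

lemma translation_mul_finiteWeyl (l : N) (v : P.weylGroup) :
    translation P l * finiteWeyl P v = ⟨Multiplicative.ofAdd l, v⟩ :=
  (SemidirectProduct.mk_eq_inl_mul_inr _ _).symm

lemma affineRefl_right (γ : AffineRoot P) : (affineRefl γ).right = weylGroup.ofIdx P γ.1 := by
  rw [affineRefl, translation_mul_finiteWeyl]

lemma transl_affineRefl (γ : AffineRoot P) : transl (affineRefl γ) = -γ.2 • P.coroot γ.1 := by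
  rw [affineRefl, translation_mul_finiteWeyl]
  rfl

lemma affineWeyl_ext {w w' : AffineWeyl P} (h : transl w = transl w')
    (h' : w.right = w'.right) : w = w' :=
  SemidirectProduct.ext (Multiplicative.toAdd.injective h) h'

lemma affineRefl_smul (w : AffineWeyl P) (γ : AffineRoot P) :
    affineRefl (w • γ) = w * affineRefl γ * w⁻¹ := by
  rw [eq_mul_inv_iff_mul_eq]
  refine affineWeyl_ext ?_ ?_
  · rw [transl_mul, transl_mul, transl_affineRefl, transl_affineRefl, affineRefl_right,
      affine_smul_fst, affine_smul_snd, coact_map_zsmul, coact_coroot, coact_ofIdx]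
    module
  · rw [SemidirectProduct.mul_right, SemidirectProduct.mul_right, affineRefl_right,
      affineRefl_right, affine_smul_fst, ofIdx_weylGroupToPerm, inv_mul_cancel_right]

lemma affineRefl_mul_self (γ : AffineRoot P) : affineRefl γ * affineRefl γ = 1 := by
  refine affineWeyl_ext ?_ ?_
  · rw [transl_mul, transl_affineRefl, affineRefl_right, coact_map_zsmul, coact_coroot,
      weylGroupToPerm_ofIdx, coroot_reflectionPerm, coreflection_apply_self, transl_one]
    module
  · rw [SemidirectProduct.mul_right, affineRefl_right, ofIdx_mul_self]
    rfl

lemma affineRefl_smul_self (γ : AffineRoot P) :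
    affineRefl γ • γ = ((P.reflectionPerm γ.1 γ.1, -γ.2) : ι × ℤ) := by
  refine Prod.ext ?_ ?_
  · rw [affine_smul_fst, affineRefl_right]
    rfl
  · rw [affine_smul_snd, affineRefl_right, transl_affineRefl, weylGroupToPerm_ofIdx,
      root_reflectionPerm, reflection_apply_self]
    simp only [map_neg, map_zsmul, LinearMap.neg_apply, root_coroot_eq_pairing,
      pairing_same, smul_eq_mul]
    ring

variable (b : P.Base) (θ : ι)

/-- Positive affine roots. -/
def AffinePos (γ : AffineRoot P) : Prop := 0 < γ.2 ∨ γ.2 = 0 ∧ b.IsPos γ.1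

/-- The affine simple roots; `α₀ = -θ + δ`. -/
def affineSimpleRoot : AffineIndex b → AffineRoot P
  | none => (P.reflectionPerm θ θ, 1)
  | some i => ((i : ι), 0)

lemma affineSimpleRoot_fst (i : AffineIndex b) :
    (affineSimpleRoot b θ i).1 = simpleRootIdx b θ i := by
  cases i <;> rfl

lemma affineRefl_simpleRoot (i : AffineIndex b) :
    affineRefl (affineSimpleRoot b θ i) = simpleRefl b θ i := by
  cases i with
  | none =>
    have h1 : weylGroup.ofIdx P (P.reflectionPerm θ θ) = weylGroup.ofIdx P θ := by
      rw [← weylGroupToPerm_ofIdx, ofIdx_weylGroupToPerm, mul_inv_cancel_right]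
    simp [affineRefl, affineSimpleRoot, simpleRefl, h1, coroot_reflectionPerm]
  | some i => simp [affineRefl, affineSimpleRoot, simpleRefl, translation]

lemma affinePos_neg (γ : AffineRoot P) :
    AffinePos b (affineRefl γ • γ) ↔ ¬ AffinePos b γ := by
  have h := Base.IsPos.neg_iff_not b γ.1
  change b.IsPos (P.reflectionPerm γ.1 γ.1) ↔ _ at h
  rw [affineRefl_smul_self]
  change 0 < -γ.2 ∨ -γ.2 = 0 ∧ _ ↔ ¬ (0 < γ.2 ∨ γ.2 = 0 ∧ b.IsPos γ.1)
  rw [h]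
  rcases lt_trichotomy γ.2 0 with h' | h' | h'
  · exact ⟨fun _ => by rintro (h | h) <;> omega, fun _ => Or.inl (by omega)⟩
  · simp [h']
  · exact ⟨fun h => by omega, fun h => absurd (Or.inl h') h⟩

lemma exists_sum_of_mem_closure {x : L}
    (hx : x ∈ AddSubmonoid.closure (P.root '' (b.support : Set ι))) :
    ∃ f : ι → ℕ, x = ∑ j ∈ b.support, f j • P.root j := by
  classical
  induction hx using AddSubmonoid.closure_induction with
  | mem x hx =>
    obtain ⟨j, hj, rfl⟩ := hx
    refine ⟨Pi.single j 1, ?_⟩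
    rw [Finset.sum_eq_single_of_mem j hj fun i _ hij => by simp [hij]]
    simp
  | zero => exact ⟨0, by simp⟩
  | add x y _ _ hx hy =>
    obtain ⟨f, rfl⟩ := hx
    obtain ⟨g, rfl⟩ := hy
    exact ⟨f + g, by simp [add_smul, Finset.sum_add_distrib]⟩

/-! ### Heights and pairings with the highest root -/

variable {b θ}

/-- The height adds up the coefficients of `θ - α` in the simple roots, which are nonnegative and
vanish together only for `α = θ`. Every later property of `θ` is derived from this strict
maximality. -/
lemma IsHighestRoot.height (hθ : IsHighestRoot b θ) (i : ι) :
    b.height i < b.height θ ∨ i = θ := by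
  obtain ⟨f, hf⟩ := exists_sum_of_mem_closure b (hθ i)
  obtain ⟨g, -, -, hg⟩ := b.exists_root_eq_sum_int i
  have h1 : P.root θ = ∑ j ∈ b.support, (fun j => (f j : ℤ) + g j) j • P.root j := by
    simp only [add_smul, Finset.sum_add_distrib, natCast_zsmul, ← hf, ← hg]
    abel
  rw [Base.height_eq_sum h1, Base.height_eq_sum hg, Finset.sum_add_distrib]
  by_cases h : ∃ j ∈ b.support, f j ≠ 0
  · left
    obtain ⟨j, hj, hj'⟩ := h
    have : 0 < ∑ j ∈ b.support, (f j : ℤ) :=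
      Finset.sum_pos' (fun _ _ => by positivity) ⟨j, hj, by positivity⟩
    omega
  · right
    push Not at h
    rw [Finset.sum_eq_zero fun j hj => by rw [h j hj, zero_smul], sub_eq_zero] at hf
    exact P.root.injective hf.symm

lemma height_neg (b : P.Base) (i : ι) : b.height (P.reflectionPerm i i) = -b.height i :=
  b.height_reflectionPerm_self i

lemma height_reflectionPerm (b : P.Base) (i j : ι) :
    b.height (P.reflectionPerm i j) = b.height j - P.pairing j i * b.height i := by
  rw [b.height_add_zsmul (i := j) (j := i) (z := -P.pairing j i), smul_eq_mul]
  · ring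
  · rw [root_reflectionPerm, reflection_apply, neg_smul, sub_eq_add_neg]
    rfl

lemma IsHighestRoot.height_pos (hθ : IsHighestRoot b θ) : 0 < b.height θ := by
  rcases hθ.height (P.reflectionPerm θ θ) with h | h
  · rw [height_neg] at h
    omega
  · have := height_neg b θ
    rw [h] at this
    have := b.height_ne_zero θ
    omega

/-- Were the pairing at least two, `-s_θ(α)` would have height at least `2 ht θ - ht α`, which
exceeds `ht θ`. -/
lemma IsHighestRoot.pairing_le (hθ : IsHighestRoot b θ) {i : ι} (hi : i ≠ θ) :
    P.pairing i θ ≤ 1 := by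
  by_contra! h
  have h1 := hθ.height i
  have h2 := hθ.height_pos
  have h3 := hθ.height (P.reflectionPerm (P.reflectionPerm θ i) (P.reflectionPerm θ i))
  rw [height_neg, height_reflectionPerm] at h3
  have h4 : 2 * b.height θ ≤ P.pairing i θ * b.height θ :=
    mul_le_mul_of_nonneg_right (by omega) h2.le
  rcases h3 with h3 | h3
  · rcases h1 with h1 | h1
    · omega
    · exact hi h1
  · have h5 := congrArg b.height h3
    rw [height_neg, height_reflectionPerm] at h5
    rcases h1 with h1 | h1
    · omega
    · exact hi h1

lemma IsHighestRoot.le_pairing (hθ : IsHighestRoot b θ) {i : ι}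
    (hi : i ≠ P.reflectionPerm θ θ) : -1 ≤ P.pairing i θ := by
  have h : P.reflectionPerm i i ≠ θ := by
    rintro h
    apply hi
    apply P.root.injective
    rw [root_reflectionPerm, reflection_apply_self, ← h, root_reflectionPerm,
      reflection_apply_self, neg_neg]
  have := hθ.pairing_le h
  rw [pairing_reflectionPerm_self_left] at this
  omega

/-- With a negative pairing, `s_θ(α)` would be higher than `θ`. -/
lemma IsHighestRoot.pairing_nonneg (hθ : IsHighestRoot b θ) {i : ι} (hi : b.IsPos i) :
    0 ≤ P.pairing i θ := by
  by_contra! h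
  have h1 := hθ.height (P.reflectionPerm θ i)
  have h2 := hθ.height_pos
  have h3 := b.isPos_iff.mp hi
  have h4 : P.pairing i θ * b.height θ ≤ -1 * b.height θ :=
    mul_le_mul_of_nonneg_right (by omega) h2.le
  rcases h1 with h1 | h1
  · rw [height_reflectionPerm] at h1
    omega
  · have h5 := congrArg b.height h1
    rw [height_reflectionPerm] at h5
    omega

/-- A finite simple reflection keeps the level `m` and permutes the positive roots other than its
own. For `s_0` one has `α + mδ ↦ s_θ(α) + (m + ⟨α, θ^∨⟩)δ`, and the bounds on `⟨α, θ^∨⟩` decide the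
sign. -/
lemma eq_affineSimpleRoot [Finite ι] [P.IsReduced] (hθ : IsHighestRoot b θ) (j : AffineIndex b)
    (γ : AffineRoot P) (h : AffinePos b γ) (h' : ¬ AffinePos b (simpleRefl b θ j • γ)) :
    γ = affineSimpleRoot b θ j := by
  cases j with
  | some j =>
    have h1 : simpleRefl b θ (some j) • γ =
        ((P.reflectionPerm j γ.1, γ.2) : ι × ℤ) := by
      refine Prod.ext rfl ?_
      rw [affine_smul_snd]
      simp [simpleRefl, finiteWeyl, transl]
    rw [h1] at h'
    obtain ⟨i, m⟩ := γ
    simp only [AffinePos] at h h'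
    push Not at h'
    obtain ⟨h2, h3⟩ : m = 0 ∧ b.IsPos i := by
      rcases h with h | h
      · omega
      · exact h
    have h4 := h'.2 h2
    by_contra hne
    refine h4 (h3.reflectionPerm j.2 fun hij => hne ?_)
    rw [affineSimpleRoot, h2, hij]
  | none =>
    have h1 : simpleRefl b θ none • γ =
        ((P.reflectionPerm θ γ.1, γ.2 + P.pairing γ.1 θ) : ι × ℤ) := by
      refine Prod.ext rfl ?_
      rw [affine_smul_snd]
      have h2 : transl (simpleRefl b θ none) = P.coroot θ := by
        simp [simpleRefl, finiteWeyl, transl, translation]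
      have h3 : (simpleRefl b θ none).right = weylGroup.ofIdx P θ := by
        simp [simpleRefl, finiteWeyl, translation]
      rw [h2, h3, weylGroupToPerm_ofIdx, root_coroot_eq_pairing,
        ← pairing_reflectionPerm, pairing_reflectionPerm_self_right]
      exact sub_neg_eq_add _ _
    rw [h1] at h'
    obtain ⟨i, m⟩ := γ
    simp only [AffinePos] at h h'
    rw [b.isPos_iff'] at h h'
    rw [height_reflectionPerm] at h'
    push Not at h'
    have h2 := hθ.height_pos
    have h3 := b.height_ne_zero i
    -- For `α = -θ` the level drops by two and the finite part becomes `θ`, so only `m = 1` is made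
    -- negative. Otherwise the pairing is at least `-1`. A positive root could become negative only
    -- at level zero: from `m = 1`, where `α + θ` would have to be negative, or from `m = 0` with
    -- pairing zero, where `α` is unchanged.
    by_cases hi : i = P.reflectionPerm θ θ
    · subst hi
      have h4 : P.pairing (P.reflectionPerm θ θ) θ = -2 := by
        rw [pairing_reflectionPerm_self_left, pairing_same]
      have h5 := height_neg b θ
      rw [h4, h5] at h'
      rw [h5] at h
      have h6 : m = 1 := by
        obtain ⟨h7, h8⟩ := h'
        by_contra hm
        have h9 : m = 2 := by omega
        subst h9
        have := h8 (by norm_num)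
        omega
      subst h6
      rfl
    · exfalso
      have h4 := hθ.le_pairing hi
      obtain ⟨h5, h6⟩ := h'
      rcases h with h | ⟨h, h7⟩
      · have h8 : P.pairing i θ = -1 := by omega
        have h9 : m = 1 := by omega
        subst h9
        rw [h8] at h6
        have h10 := h6 (by norm_num)
        have h11 := hθ.height (P.reflectionPerm i i)
        rw [height_neg] at h11
        rcases h11 with h11 | h11
        · omega
        · have h12 := congrArg b.height h11
          rw [height_neg] at h12
          omega
      · have h8 := hθ.pairing_nonneg (b.isPos_iff'.mpr h7)
        have h9 : P.pairing i θ = 0 := by omega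
        rw [h9] at h6
        have := h6 (by omega)
        omega

/-- The affine reflection system. -/
def affineSystem [Finite ι] [P.IsReduced] (hθ : IsHighestRoot b θ)
    (hgen : ∀ w : AffineWeyl P, ∃ I, wordProd b θ I = w) :
    ReflectionSystem (AffineWeyl P) (AffineIndex b) (AffineRoot P) where
  s := simpleRefl b θ
  root := affineSimpleRoot b θ
  refl := affineRefl
  pos := AffinePos b
  refl_smul := affineRefl_smul
  refl_root := affineRefl_simpleRoot b θ
  refl_mul_self := affineRefl_mul_self
  pos_root j := by
    cases j with
    | none => exact Or.inl Int.one_pos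
    | some j => exact Or.inr ⟨rfl, b.isPos_of_mem_support j.2⟩
  pos_neg := affinePos_neg b
  eq_root := eq_affineSimpleRoot hθ
  exists_word := hgen

end Affine

end AffineFADA
end

/-! ### The affine root lattice -/

noncomputable section
namespace AffineFADA

open RootPairing

section AffineLattice

variable {ι L N : Type*} [AddCommGroup L] [AddCommGroup N] (P : RootPairing ι ℤ L N)

/-- The affine root lattice `Q ⊕ ℤ δ`. -/
abbrev AffineLattice : Type _ := P.rootSpan ℤ × ℤ

variable {P}

lemma smul_mem_rootSpan (v : P.weylGroup) {x : L} (hx : x ∈ P.rootSpan ℤ) :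
    v • x ∈ P.rootSpan ℤ := by
  induction hx using Submodule.span_induction with
  | mem x hx =>
    obtain ⟨i, rfl⟩ := hx
    rw [weylGroup_apply_root]
    exact Submodule.subset_span ⟨_, rfl⟩
  | zero => rw [smul_zero]; exact zero_mem _
  | add x y _ _ hx hy => rw [smul_add]; exact add_mem hx hy
  | smul a x _ hx =>
    have h : v • a • x = a • v • x := map_zsmul (DistribSMul.toAddMonoidHom L v) a x
    rw [h]
    exact Submodule.smul_mem _ a hx

/-- The action of the affine Weyl group on the affine root lattice:
`(t_λ w)(μ + m δ) = w(μ) + (m - ⟨w(μ), λ⟩) δ`. -/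
def affineEnd : AffineWeyl P →* AddMonoid.End (AffineLattice P) where
  toFun w :=
    { toFun := fun x => (⟨w.right • (x.1 : L), smul_mem_rootSpan _ x.1.2⟩,
        x.2 - P.toLinearMap (w.right • (x.1 : L)) (transl w))
      map_zero' := by
        refine Prod.ext (Subtype.ext ?_) ?_ <;> simp
      map_add' := fun x y => by
        refine Prod.ext (Subtype.ext ?_) ?_
        · simp
        · simp only [Prod.fst_add, Prod.snd_add, Submodule.coe_add, smul_add, map_add,
            LinearMap.add_apply]
          ring }
  map_one' := by
    refine AddMonoidHom.ext fun x => Prod.ext (Subtype.ext ?_) ?_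
    · exact one_smul _ _
    · change x.2 - P.toLinearMap _ (0 : N) = x.2
      rw [map_zero, sub_zero]
  map_mul' w w' := by
    refine AddMonoidHom.ext fun x => Prod.ext (Subtype.ext ?_) ?_
    · exact mul_smul _ _ _
    · change x.2 - P.toLinearMap ((w * w').right • (x.1 : L)) (transl (w * w')) =
        x.2 - P.toLinearMap (w'.right • (x.1 : L)) (transl w') -
          P.toLinearMap (w.right • w'.right • (x.1 : L)) (transl w)
      rw [SemidirectProduct.mul_right, mul_smul, transl_mul, map_add, toLinearMap_smul_coact]
      ring

lemma affineEnd_fst (w : AffineWeyl P) (x : AffineLattice P) :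
    ((affineEnd w x).1 : L) = w.right • (x.1 : L) := rfl

lemma affineEnd_snd (w : AffineWeyl P) (x : AffineLattice P) :
    (affineEnd w x).2 = x.2 - P.toLinearMap (w.right • (x.1 : L)) (transl w) := rfl

/-- An affine root as an element of the affine root lattice. -/
def rootVec (γ : AffineRoot P) : AffineLattice P := (P.rootSpanMem ℤ γ.1, γ.2)

lemma rootVec_fst (γ : AffineRoot P) : ((rootVec γ).1 : L) = P.root γ.1 := rfl

lemma rootVec_snd (γ : AffineRoot P) : (rootVec γ).2 = γ.2 := rfl

lemma affineEnd_rootVec (w : AffineWeyl P) (γ : AffineRoot P) :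
    affineEnd w (rootVec γ) = rootVec (w • γ) := by
  refine Prod.ext (Subtype.ext ?_) ?_
  · rw [affineEnd_fst, rootVec_fst, rootVec_fst, weylGroup_apply_root]
    rfl
  · rw [affineEnd_snd, rootVec_fst, weylGroup_apply_root]
    rfl

lemma rootVec_neg (γ : AffineRoot P) : rootVec (affineRefl γ • γ) = -rootVec γ := by
  rw [affineRefl_smul_self]
  refine Prod.ext (Subtype.ext ?_) rfl
  change P.root (P.reflectionPerm γ.1 γ.1) = -P.root γ.1
  rw [root_reflectionPerm, reflection_apply_self]

lemma affineEnd_affineRefl (γ : AffineRoot P) (x : AffineLattice P) :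
    affineEnd (affineRefl γ) x =
      x + (-P.toLinearMap (x.1 : L) (P.coroot γ.1)) • rootVec γ := by
  refine Prod.ext (Subtype.ext ?_) ?_
  · rw [affineEnd_fst, affineRefl_right, ofIdx_smul_eq, Prod.fst_add, Submodule.coe_add,
      Prod.smul_fst, Submodule.coe_smul, rootVec_fst, neg_smul, sub_eq_add_neg]
  · rw [affineEnd_snd, affineRefl_right, transl_affineRefl, ofIdx_smul_eq, Prod.snd_add,
      Prod.smul_snd, rootVec_snd]
    simp only [map_sub, map_zsmul, LinearMap.sub_apply, LinearMap.smul_apply,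
      root_coroot_eq_pairing, pairing_same, smul_eq_mul]
    ring

lemma rootVec_ne_zero (γ : AffineRoot P) : rootVec γ ≠ 0 := by
  intro h
  have h1 : P.root γ.1 = 0 := by rw [← rootVec_fst, h]; rfl
  exact P.ne_zero γ.1 h1

/-- Reducedness gives proportional finite parts equal up to sign, and pairing with the coroot then
forces `k = ±1`, which fixes the levels too. -/
lemma eq_or_eq_neg_of_rootVec [Finite ι] [P.IsReduced] {β γ : AffineRoot P} {k : ℤ}
    (h : rootVec β = k • rootVec γ) : β = γ ∨ β = affineRefl γ • γ := by
  have h1 : P.root β.1 = k • P.root γ.1 := by rw [← rootVec_fst, h]; rfl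
  have h2 : β.2 = k * γ.2 := by rw [← rootVec_snd, h]; rfl
  have h3 : ¬ LinearIndependent ℤ ![P.root β.1, P.root γ.1] := by
    intro h3
    have := (LinearIndependent.pair_iff.mp h3) 1 (-k) (by rw [h1]; module)
    exact one_ne_zero this.1
  have h4 : 2 * k = P.pairing β.1 γ.1 := by
    rw [← root_coroot_eq_pairing, h1, map_zsmul, LinearMap.smul_apply, root_coroot_eq_pairing,
      pairing_same, smul_eq_mul, mul_comm]
  rcases IsReduced.eq_or_eq_neg β.1 γ.1 h3 with h5 | h5
  · left
    have h6 : β.1 = γ.1 := P.root.injective h5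
    rw [h6, pairing_same] at h4
    exact Prod.ext h6 (by rw [h2, show k = 1 by omega, one_mul])
  · right
    have h6 : β.1 = P.reflectionPerm γ.1 γ.1 := P.root.injective (by
      rw [h5, root_reflectionPerm, reflection_apply_self])
    rw [h6, pairing_reflectionPerm_self_left, pairing_same] at h4
    rw [affineRefl_smul_self]
    exact Prod.ext h6 (by rw [h2, show k = -1 by omega, neg_one_mul])

/-- This is why the model lives over the root lattice and not over `L`, where a root may be
divisible: for `SL₂` the simple root is twice the fundamental weight. The affine node is detected by
the coefficient of `δ`. -/
lemma exists_functional_affineSimpleRoot (b : P.Base) (θ : ι) (j : AffineIndex b) :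
    ∃ f : AffineLattice P →+ ℤ, f (rootVec (affineSimpleRoot b θ j)) = 1 := by
  cases j with
  | none => exact ⟨AddMonoidHom.snd _ _, rfl⟩
  | some j =>
    refine ⟨(b.toWeightBasisInt.coord j).toAddMonoidHom.comp (AddMonoidHom.fst _ _), ?_⟩
    change b.toWeightBasisInt.coord j (P.rootSpanMem ℤ j) = 1
    have : P.rootSpanMem ℤ j = b.toWeightBasisInt j := by
      refine Subtype.ext ?_
      rw [b.coe_toWeightBasisInt_apply]
    rw [this]
    simp

end AffineLattice

/-- A ring with elements `x_μ` indexed by a lattice, with an action of the endomorphisms of the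
lattice, sharing the formal properties of formal group algebras. -/
structure LatticeModel (Λ : Type*) [AddCommGroup Λ] where
  carrier : Type*
  [commRing : CommRing carrier]
  x : Λ → carrier
  map : (Λ →+ Λ) → (carrier →+* carrier)
  map_x : ∀ g μ, map g (x μ) = x (g μ)
  map_id : map (AddMonoidHom.id Λ) = RingHom.id carrier
  map_comp : ∀ g h, map (g.comp h) = (map g).comp (map h)
  x_zero : x 0 = 0
  mul_dvd_add : ∀ μ, x μ * x (-μ) ∣ x μ + x (-μ)
  dvd_sub_map : ∀ γ (g : Λ →+ Λ), (∀ μ, ∃ k : ℤ, g μ = μ + k • γ) → ∀ p, x γ ∣ p - map g p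

attribute [instance] LatticeModel.commRing

namespace LatticeModel

section

variable {Λ : Type*} [AddCommGroup Λ] (M : LatticeModel Λ)

/-- If `f γ = 1` for a linear form `f`, then `x_γ` generates a prime ideal. -/
lemma dvd_of_dvd_mul [IsDomain M.carrier] (hx : ∀ μ, μ ≠ 0 → M.x μ ≠ 0) {β γ : Λ} (f : Λ →+ ℤ)
    (hf : f γ = 1) (hβ : ∀ k : ℤ, β ≠ k • γ) {p : M.carrier} (h : M.x γ ∣ M.x β * p) :
    M.x γ ∣ p := by
  -- `g` is the projection along `γ` onto the kernel of `f`. The induced map kills `x_γ` and is the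
  -- identity modulo `x_γ`, so in a domain it detects divisibility by `x_γ`.
  set g : Λ →+ Λ := AddMonoidHom.id Λ - (zmultiplesHom Λ γ).comp f with hg
  have hg' : ∀ μ, g μ = μ - f μ • γ := fun μ => by simp [hg]
  have h1 := map_dvd (M.map g) h
  rw [map_mul, M.map_x, M.map_x, hg' γ, hf, one_smul, sub_self, M.x_zero, zero_dvd_iff,
    mul_eq_zero] at h1
  have h2 : M.x (g β) ≠ 0 := hx _ (by
    rw [hg', sub_ne_zero]
    exact hβ _)
  have h3 := M.dvd_sub_map γ g (fun μ => ⟨-f μ, by rw [hg', neg_smul, sub_eq_add_neg]⟩) p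
  rwa [h1.resolve_left h2, sub_zero] at h3

/-- The action of the endomorphisms of the lattice. -/
def mapHom : AddMonoid.End Λ →* (M.carrier →+* M.carrier) where
  toFun := M.map
  map_one' := M.map_id
  map_mul' := M.map_comp

end

variable {ι L N : Type*} [AddCommGroup L] [AddCommGroup N] {P : RootPairing ι ℤ L N}
  (M : LatticeModel (AffineLattice P))

instance affineAction : MulSemiringAction (AffineWeyl P) M.carrier :=
  MulSemiringAction.compHom M.carrier (M.mapHom.comp affineEnd)

/-- The elements `x_γ` for affine roots `γ`. -/
def rootFunction [Finite ι] [P.IsReduced] {b : P.Base} {θ : ι} (hθ : IsHighestRoot b θ)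
    (hgen : ∀ w : AffineWeyl P, ∃ I, wordProd b θ I = w)
    [IsDomain M.carrier] (hx : ∀ μ, μ ≠ 0 → M.x μ ≠ 0) :
    ReflectionSystem.RootFunction (affineSystem hθ hgen) M.carrier where
  ξ γ := M.x (rootVec γ)
  smul_ξ w γ := (M.map_x _ _).trans (congrArg M.x (affineEnd_rootVec w γ))
  ξ_ne_zero γ := hx _ (rootVec_ne_zero γ)
  mul_dvd_add γ := by
    have : rootVec ((affineSystem hθ hgen).neg γ) = -rootVec γ := rootVec_neg γ
    rw [this]
    exact M.mul_dvd_add _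
  dvd_sub γ p := M.dvd_sub_map _ _ (fun μ => ⟨_, affineEnd_affineRefl γ μ⟩) p
  coprime β γ h h' p hp := by
    -- Every affine root is `w α_j`, so the form equal to `1` on `α_j` pulls back along `w⁻¹` to one
    -- equal to `1` on the root.
    obtain ⟨w, j, rfl⟩ := (affineSystem hθ hgen).exists_eq_smul γ
    obtain ⟨f, hf⟩ := exists_functional_affineSimpleRoot b θ j
    refine M.dvd_of_dvd_mul hx (f.comp (affineEnd w⁻¹)) ?_ (fun k hk => ?_) hp
    · change f (affineEnd w⁻¹ _) = 1
      rw [affineEnd_rootVec, inv_smul_smul]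
      exact hf
    · rcases eq_or_eq_neg_of_rootVec hk with h1 | h1
      · exact h h1
      · exact h' h1

end LatticeModel

end AffineFADA
end

/-! ### Specialization of the coefficient ring -/

noncomputable section
namespace AffineFADA

namespace ReflectionSystem.RootFunction

variable {W J Γ : Type*} [Group W] [MulAction W Γ] {X : ReflectionSystem W J Γ}
  {A : Type*} [CommRing A] [MulSemiringAction W A] (D : RootFunction X A)

/-- The localization of the coefficient ring at the elements `ξ γ`. -/
abbrev Loc : Type _ := Localization D.denominators

lemma denominators_le_comap (w : W) :
    D.denominators ≤ D.denominators.comap (MulSemiringAction.toRingHom W A w) := by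
  rw [denominators, Submonoid.closure_le]
  rintro _ ⟨γ, rfl⟩
  exact Submonoid.subset_closure ⟨w • γ, (D.smul_ξ w γ).symm⟩

/-- The action on the localization. -/
def locHom : W →* (D.Loc →+* D.Loc) where
  toFun w := IsLocalization.map D.Loc (MulSemiringAction.toRingHom W A w)
    (D.denominators_le_comap w)
  map_one' := by
    refine IsLocalization.ringHom_ext D.denominators (RingHom.ext fun a => ?_)
    simp
  map_mul' v w := by
    refine IsLocalization.ringHom_ext D.denominators (RingHom.ext fun a => ?_)
    simp [mul_smul]

instance locAction : MulSemiringAction W D.Loc := MulSemiringAction.compHom D.Loc D.locHom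

lemma loc_smul_algebraMap (w : W) (a : A) :
    w • algebraMap A D.Loc a = algebraMap A D.Loc (w • a) :=
  IsLocalization.map_eq (D.denominators_le_comap w) a

instance loc_smulDistribClass : SMulDistribClass W A D.Loc where
  smul_distrib_smul w a p := by
    rw [Algebra.smul_def, smul_mul', loc_smul_algebraMap, Algebra.smul_def]

section Specialize

variable {B' : Type*} [CommRing B'] [MulSemiringAction W B'] (f : A →+* B')
  (hf : ∀ γ, IsUnit (f (D.ξ γ)))

/-- The extension to the localization of a homomorphism inverting the `ξ γ`. -/
def locLift : D.Loc →+* B' :=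
  IsLocalization.lift (M := D.denominators) (g := f) (by
    rintro ⟨m, hm⟩
    induction hm using Submonoid.closure_induction with
    | mem m hm =>
      obtain ⟨γ, rfl⟩ := hm
      exact hf γ
    | one => simp
    | mul m m' _ _ h h' =>
      change IsUnit (f (m * m'))
      rw [map_mul]
      exact h.mul h')

omit [MulSemiringAction W B'] in
lemma locLift_algebraMap (a : A) : D.locLift f hf (algebraMap A D.Loc a) = f a :=
  IsLocalization.lift_eq _ a

lemma locLift_smul (h : ∀ (w : W) a, f (w • a) = w • f a) (w : W) (p : D.Loc) :
    D.locLift f hf (w • p) = w • D.locLift f hf p := by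
  have : (D.locLift f hf).comp (D.locHom w) =
      (MulSemiringAction.toRingHom W B' w).comp (D.locLift f hf) := by
    refine IsLocalization.ringHom_ext D.denominators (RingHom.ext fun a => ?_)
    change D.locLift f hf (w • algebraMap A D.Loc a) = w • D.locLift f hf (algebraMap A D.Loc a)
    rw [loc_smul_algebraMap, locLift_algebraMap, locLift_algebraMap, h]
  exact RingHom.congr_fun this p

omit [MulSemiringAction W B'] in
lemma locLift_inv_eq {γ : Γ} {c : B'} (hc : f (D.ξ γ) * c = 1) :
    D.locLift f hf (D.inv D.Loc γ) = c := by
  have h := congrArg (D.locLift f hf) (D.mul_inv D.Loc γ)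
  rw [map_mul, locLift_algebraMap, map_one] at h
  calc _ = (f (D.ξ γ) * c) * D.locLift f hf (D.inv D.Loc γ) := by rw [hc, one_mul]
    _ = c * (f (D.ξ γ) * D.locLift f hf (D.inv D.Loc γ)) := by ring
    _ = c := by rw [h, mul_one]

end Specialize

end ReflectionSystem.RootFunction

/-! ### Specialization `δ ↦ 0` -/

open RootPairing

variable {ι L N : Type*} [AddCommGroup L] [AddCommGroup N] {P : RootPairing ι ℤ L N}

namespace CoeffRing

variable (S : CoeffRing P)

lemma x_mul_invX (i : ι) : algebraMap S.carrier S.Q (S.x (P.root i)) * S.invX i = 1 := by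
  rw [invX, mul_comm, IsLocalization.mk'_spec]
  simp

lemma smul_def (w : AffineWeyl P) (p : S.Q) : w • p = S.actQ w.right p := rfl

lemma smul_algebraMap (w : AffineWeyl P) (a : S.carrier) :
    w • algebraMap S.carrier S.Q a = algebraMap S.carrier S.Q (S.act w.right a) :=
  IsLocalization.map_eq (S.rootMonoid_le_comap w.right) a

lemma smul_invX (w : AffineWeyl P) (i : ι) :
    w • S.invX i = S.invX (P.weylGroupToPerm w.right i) := by
  have h := congrArg (w • ·) (S.x_mul_invX i)
  simp only [smul_mul', smul_algebraMap, S.act_x, weylGroup_apply_root, smul_one] at h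
  calc _ = (algebraMap S.carrier S.Q (S.x (P.root (P.weylGroupToPerm w.right i))) *
        S.invX (P.weylGroupToPerm w.right i)) * w • S.invX i := by rw [x_mul_invX, one_mul]
    _ = S.invX (P.weylGroupToPerm w.right i) *
        (algebraMap S.carrier S.Q (S.x (P.root (P.weylGroupToPerm w.right i))) *
          w • S.invX i) := by ring
    _ = _ := by rw [h, mul_one]

variable [Finite ι] [P.IsReduced] {b : P.Base} {θ : ι}

lemma demazureSeq_eq (hθ : IsHighestRoot b θ)
    (hgen : ∀ w : AffineWeyl P, ∃ I, wordProd b θ I = w) (I : List (AffineIndex b)) :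
    S.demazureSeq b θ I =
      (affineSystem hθ hgen).demSeq (fun j => S.invX (simpleRootIdx b θ j)) I := rfl

/-- The span over `S` of the products of Demazure elements along a choice of reduced words
contains all products of Demazure elements, provided the coefficient ring is a specialization
of a model over the affine root lattice. -/
theorem demazureSeq_mem_span (hθ : IsHighestRoot b θ)
    (hgen : ∀ w : AffineWeyl P, ∃ I, wordProd b θ I = w) (M : LatticeModel (AffineLattice P)) [IsDomain M.carrier]
    (hx : ∀ μ, μ ≠ 0 → M.x μ ≠ 0) (φ : M.carrier →+* S.carrier)
    (hφx : ∀ μ, φ (M.x μ) = S.x μ.1)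
    (hφ : ∀ (w : AffineWeyl P) p, φ (M.map (affineEnd w) p) = S.act w.right (φ p))
    {I : AffineWeyl P → List (AffineIndex b)} (hI : ∀ w, IsReducedSeq b θ (I w) w)
    (I' : List (AffineIndex b)) :
    S.demazureSeq b θ I' ∈
      Submodule.span S.carrier (Set.range fun w => S.demazureSeq b θ (I w)) := by
  set D := M.rootFunction hθ hgen hx with hD
  -- Under `φ` the element of `α + mδ` becomes `x_α`, which is invertible in `Q`; hence the
  -- specialization extends to the localized model.
  have hξ : ∀ γ : AffineRoot P, ((algebraMap S.carrier S.Q).comp φ) (D.ξ γ) * S.invX γ.1 = 1 := by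
    intro γ
    change algebraMap S.carrier S.Q (φ (M.x (rootVec γ))) * _ = 1
    rw [hφx, rootVec_fst]
    exact S.x_mul_invX γ.1
  have hunit : ∀ γ, IsUnit (((algebraMap S.carrier S.Q).comp φ) (D.ξ γ)) := fun γ =>
    IsUnit.of_mul_eq_one _ (hξ γ)
  set f := D.locLift ((algebraMap S.carrier S.Q).comp φ) hunit with hf
  have hequiv : ∀ (w : AffineWeyl P) (p : D.Loc), f (w • p) = w • f p :=
    D.locLift_smul _ hunit fun w a => by
      change algebraMap S.carrier S.Q (φ (M.map (affineEnd w) a)) = _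
      rw [hφ]
      exact (S.smul_algebraMap w (φ a)).symm
  have hinv : (fun j => f (D.inv D.Loc ((affineSystem hθ hgen).root j))) =
      fun j => S.invX (simpleRootIdx b θ j) := by
    ext j
    rw [← affineSimpleRoot_fst]
    exact D.locLift_inv_eq _ hunit (hξ _)
  have hmap : ∀ I' : List (AffineIndex b), ReflectionSystem.mapTwisted f hequiv
      ((affineSystem hθ hgen).demSeq
        (fun j => D.inv D.Loc ((affineSystem hθ hgen).root j)) I') = S.demazureSeq b θ I' := by
    intro I'
    rw [ReflectionSystem.mapTwisted_demSeq, hinv, demazureSeq_eq]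
  have key := ReflectionSystem.RootFunction.mem_span_of_residue (D := D) (B := D.Loc)
    (I := I) (fun w => (hI w).1) (fun w => (hI w).2)
    (fun γ => ReflectionSystem.RootFunction.residue_demSeq (D := D) (B := D.Loc) I' γ)
  suffices h : ∀ z ∈ Submodule.span M.carrier (Set.range fun w =>
      (affineSystem hθ hgen).demSeq
        (fun j => D.inv D.Loc ((affineSystem hθ hgen).root j)) (I w)),
      ReflectionSystem.mapTwisted f hequiv z ∈
        Submodule.span S.carrier (Set.range fun w => S.demazureSeq b θ (I w)) by
    rw [← hmap I']
    exact h _ key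
  intro z hz
  induction hz using Submodule.span_induction with
  | mem z hz =>
    obtain ⟨w, rfl⟩ := hz
    rw [hmap]
    exact Submodule.subset_span ⟨w, rfl⟩
  | zero => rw [map_zero]; exact zero_mem _
  | add y z _ _ hy hz => rw [map_add]; exact add_mem hy hz
  | smul a z _ hz =>
    have h : f (algebraMap M.carrier D.Loc a) = algebraMap S.carrier S.Q (φ a) :=
      D.locLift_algebraMap _ hunit a
    rw [← algebraMap_smul D.Loc a z, ReflectionSystem.mapTwisted_smul, h, algebraMap_smul]
    exact Submodule.smul_mem _ _ hz

end CoeffRing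

end AffineFADA
end

/-! ### The span of the products of Demazure elements -/

noncomputable section
namespace AffineFADA

open RootPairing SkewMonoidAlgebra

variable {ι L N : Type*} [AddCommGroup L] [AddCommGroup N] {P : RootPairing ι ℤ L N}

/-- A root as an affine root. -/
def finiteRoot (i : ι) : AffineRoot P := (i, (0 : ℤ))

lemma finiteRoot_fst (i : ι) : (finiteRoot (P := P) i).1 = i := rfl

lemma affineRefl_finiteRoot (i : ι) :
    affineRefl (finiteRoot i) = finiteWeyl P (weylGroup.ofIdx P i) := by
  refine affineWeyl_ext ?_ (affineRefl_right _)
  rw [transl_affineRefl]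
  exact (congrArg (· • _) (_root_.neg_zero (G := ℤ))).trans (zero_smul ℤ _)

namespace CoeffRing

variable (S : CoeffRing P)

lemma η_mul_smul (w : AffineWeyl P) (p : S.Q) (z : S.QW) :
    S.η w * (p • z) = (w • p) • (S.η w * z) := by
  ext v
  simp [η, smul_mul']

lemma η_mul_η (v w : AffineWeyl P) : S.η v * S.η w = S.η (v * w) := by
  simp [η]

lemma η_one : S.η (1 : AffineWeyl P) = 1 := rfl

/-- The element `(1/x_α) (1 - η_{s_γ})` for an affine root `γ` with finite part `α`. -/
def rootDemazure (γ : AffineRoot P) : S.QW := S.invX γ.1 • (1 - S.η (affineRefl γ))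

lemma rootDemazure_def (γ : AffineRoot P) :
    S.rootDemazure γ = S.invX γ.1 • (1 - S.η (affineRefl γ)) := rfl

lemma η_mul_rootDemazure_mul (w : AffineWeyl P) (γ : AffineRoot P) :
    S.η w * S.rootDemazure γ * S.η w⁻¹ = S.rootDemazure (w • γ) := by
  rw [rootDemazure, η_mul_smul, smul_mul_assoc, mul_sub, sub_mul, mul_one, η_mul_η, η_mul_η,
    η_mul_η, mul_inv_cancel, smul_invX, rootDemazure, affineRefl_smul, affine_smul_fst, η_one]

section Projection

lemma k_pr_single (w : AffineWeyl P) (p : S.Q) :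
    S.k (S.pr (single w p)) = single (SemidirectProduct.inl w.left) p := by
  change mapDomain _ (mapDomain _ (single w p)) = _
  rw [mapDomain_single, mapDomain_single]

lemma pr_single (w : AffineWeyl P) (p : S.Q) : S.pr (single w p) = single w.left p :=
  mapDomain_single

lemma k_single (l : Multiplicative N) (p : S.Q) :
    S.k (single l p) = single (SemidirectProduct.inl l) p :=
  mapDomain_single

lemma k_smul (p : S.Q) (z : S.QT) : S.k (p • z) = p • S.k z :=
  mapDomain_smul

lemma k_pr_smul (p : S.Q) (z : S.QW) : S.k (S.pr (p • z)) = p • S.k (S.pr z) := by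
  rw [map_smul, k_smul]

lemma k_pr_one : S.k (S.pr (1 : S.QW)) = 1 := S.k_pr_single 1 1

/-- Translations act trivially on `Q`, so the image of `k` commutes with scalars. -/
lemma k_mul_smul (y : S.QT) (p : S.Q) (z : S.QW) : S.k y * (p • z) = p • (S.k y * z) := by
  induction y using SkewMonoidAlgebra.induction_on with
  | zero => simp
  | single l q =>
    have h : (SemidirectProduct.inl l : AffineWeyl P) • p = p := by
      rw [smul_def, SemidirectProduct.right_inl, map_one]
      rfl
    have h' : S.k (single l q) = q • S.η (SemidirectProduct.inl l) := by
      rw [k_single, η, smul_single, smul_eq_mul, mul_one]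
    rw [h', smul_mul_assoc, η_mul_smul, h, smul_mul_assoc, smul_comm]
  | add y y' hy hy' => rw [map_add, add_mul, hy, hy', add_mul, smul_add]

/-- For `g = t_λ w`, the translation part of `g t_μ x` is `g t_μ w⁻¹`. -/
lemma k_pr_η_mul (g : AffineWeyl P) (z : S.QW) :
    S.k (S.pr (S.η g * z)) = S.η g * S.k (S.pr z) * S.η (finiteWeyl P g.right⁻¹) := by
  induction z using SkewMonoidAlgebra.induction_on with
  | zero => simp
  | single w p =>
    rw [η, η, single_mul_single, k_pr_single, k_pr_single, single_mul_single, single_mul_single]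
    congr 1
    · refine SemidirectProduct.ext ?_ ?_
      · simp [finiteWeyl]
      · simp [finiteWeyl]
    · simp
  | add y y' hy hy' => simp only [map_add, mul_add, add_mul, hy, hy']

variable (b : P.Base) (θ : ι)

lemma demazure_eq_rootDemazure (j : AffineIndex b) :
    S.demazure b θ j = S.rootDemazure (affineSimpleRoot b θ j) := by
  rw [demazure, rootDemazure, affineRefl_simpleRoot, affineSimpleRoot_fst]

/-- With `y = k(pr z)` and `α` the finite part of `γ`, the left side is `(1/x_α)(y - η_{s_γ} y
η_{s_α})`. Insert `η_{s_γ} y`. In the second difference `1/x_α` moves to the right: it becomes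
`1/x_{-α}` past `η_{s_γ}` and commutes with `y`, which produces the finite element for `-α`. -/
lemma k_pr_rootDemazure_mul (γ : AffineRoot P) (z : S.QW) :
    S.k (S.pr (S.rootDemazure γ * z)) = S.rootDemazure γ * S.k (S.pr z) +
      S.η (affineRefl γ) * S.k (S.pr z) *
        S.rootDemazure (finiteRoot (P.reflectionPerm γ.1 γ.1)) := by
  have h1 : finiteWeyl P (affineRefl γ).right⁻¹ =
      affineRefl (finiteRoot (P.reflectionPerm γ.1 γ.1)) := by
    have h : weylGroup.ofIdx P (P.reflectionPerm γ.1 γ.1) = weylGroup.ofIdx P γ.1 := by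
      rw [← weylGroupToPerm_ofIdx, ofIdx_weylGroupToPerm, mul_inv_cancel_right]
    rw [affineRefl_finiteRoot, h, affineRefl_right, inv_eq_of_mul_eq_one_left (ofIdx_mul_self P _)]
  have h2 : affineRefl γ • S.invX (finiteRoot (P := P) (P.reflectionPerm γ.1 γ.1)).1 = S.invX γ.1 := by
    rw [smul_invX, affineRefl_right, weylGroupToPerm_ofIdx, finiteRoot_fst]
    congr 1
    exact P.reflectionPerm_self γ.1 _
  rw [S.rootDemazure_def (finiteRoot _), mul_assoc, k_mul_smul, η_mul_smul, h2, rootDemazure_def,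
    smul_mul_assoc, k_pr_smul, sub_mul, one_mul, map_sub, map_sub, k_pr_η_mul, smul_mul_assoc,
    ← smul_add, mul_sub, mul_one, sub_mul, one_mul, mul_sub, ← mul_assoc, h1]
  congr 1
  abel

end Projection

section Span

variable (b : P.Base) (θ : ι)

/-- The `S`-module spanned by the products of Demazure elements. -/
def demazureSpan : Submodule S.carrier S.QW :=
  Submodule.span S.carrier (Set.range (S.demazureSeq b θ))

variable {b θ}

lemma demazureSeq_nil : S.demazureSeq b θ [] = 1 := rfl

lemma demazureSeq_cons (j : AffineIndex b) (I : List (AffineIndex b)) :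
    S.demazureSeq b θ (j :: I) = S.demazure b θ j * S.demazureSeq b θ I := by
  simp [demazureSeq]

lemma one_mem_demazureSpan : (1 : S.QW) ∈ S.demazureSpan b θ := Submodule.subset_span ⟨[], rfl⟩

lemma demazure_mem_demazureSpan (j : AffineIndex b) : S.demazure b θ j ∈ S.demazureSpan b θ :=
  Submodule.subset_span ⟨[j], by rw [demazureSeq_cons, demazureSeq_nil, mul_one]⟩

/-- Twisted Leibniz rule; `a'` is the divided difference of `a`. -/
lemma rootDemazure_mul_smul (hS : ∀ i f, S.x (P.root i) ∣ f - S.act (weylGroup.ofIdx P i) f)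
    (γ : AffineRoot P) (a : S.carrier) (z : S.QW) :
    ∃ a' : S.carrier, S.rootDemazure γ * (a • z) =
      a' • z + S.act (weylGroup.ofIdx P γ.1) a • (S.rootDemazure γ * z) := by
  obtain ⟨a', ha'⟩ := hS γ.1 a
  refine ⟨a', ?_⟩
  have h : S.invX γ.1 * algebraMap S.carrier S.Q a =
      algebraMap S.carrier S.Q a' +
        algebraMap S.carrier S.Q (S.act (weylGroup.ofIdx P γ.1) a) * S.invX γ.1 := by
    have h1 := congrArg (algebraMap S.carrier S.Q) ha'
    rw [map_sub, map_mul] at h1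
    have h2 := S.x_mul_invX γ.1
    linear_combination S.invX γ.1 * h1 + algebraMap S.carrier S.Q a' * h2
  rw [← algebraMap_smul S.Q a, ← algebraMap_smul S.Q a', ← algebraMap_smul S.Q (S.act _ a),
    rootDemazure, smul_mul_assoc, sub_mul, η_mul_smul, smul_algebraMap, affineRefl_right,
    smul_mul_assoc, sub_mul, one_mul, one_mul, smul_sub, smul_smul, h]
  simp only [add_smul, smul_smul, smul_sub, mul_comm (S.invX _)]
  abel

lemma demazure_mul_mem (hS : ∀ i f, S.x (P.root i) ∣ f - S.act (weylGroup.ofIdx P i) f)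
    (j : AffineIndex b) {z : S.QW} (hz : z ∈ S.demazureSpan b θ) :
    S.demazure b θ j * z ∈ S.demazureSpan b θ := by
  induction hz using Submodule.span_induction with
  | mem z hz =>
    obtain ⟨I, rfl⟩ := hz
    exact Submodule.subset_span ⟨j :: I, S.demazureSeq_cons j I⟩
  | zero => rw [mul_zero]; exact zero_mem _
  | add y z _ _ hy hz => rw [mul_add]; exact add_mem hy hz
  | smul a z hz hz' =>
    rw [demazure_eq_rootDemazure] at hz' ⊢
    obtain ⟨a', ha'⟩ := S.rootDemazure_mul_smul hS (affineSimpleRoot b θ j) a z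
    rw [ha']
    exact add_mem (Submodule.smul_mem _ _ hz) (Submodule.smul_mem _ _ hz')

lemma mul_mem_demazureSpan (hS : ∀ i f, S.x (P.root i) ∣ f - S.act (weylGroup.ofIdx P i) f)
    {y z : S.QW} (hy : y ∈ S.demazureSpan b θ) (hz : z ∈ S.demazureSpan b θ) :
    y * z ∈ S.demazureSpan b θ := by
  induction hy using Submodule.span_induction with
  | mem y hy =>
    obtain ⟨I, rfl⟩ := hy
    induction I with
    | nil => rwa [demazureSeq_nil, one_mul]
    | cons j I ih =>
      rw [demazureSeq_cons, mul_assoc]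
      exact S.demazure_mul_mem hS j ih
  | zero => rw [zero_mul]; exact zero_mem _
  | add y y' _ _ hy hy' => rw [add_mul]; exact add_mem hy hy'
  | smul a y _ hy =>
    rw [← algebraMap_smul S.Q a, smul_mul_assoc, algebraMap_smul]
    exact Submodule.smul_mem _ _ hy

/-- On generators, `η_{s_j} = 1 - x_{α_j} X_j`. -/
lemma η_mem_demazureSpan (hS : ∀ i f, S.x (P.root i) ∣ f - S.act (weylGroup.ofIdx P i) f)
    (hgen : ∀ w : AffineWeyl P, ∃ I, wordProd b θ I = w) (w : AffineWeyl P) :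
    S.η w ∈ S.demazureSpan b θ := by
  obtain ⟨I, rfl⟩ := hgen w
  induction I with
  | nil => exact S.one_mem_demazureSpan
  | cons j I ih =>
    have h : wordProd b θ (j :: I) = simpleRefl b θ j * wordProd b θ I := by simp [wordProd]
    rw [h, ← η_mul_η]
    refine S.mul_mem_demazureSpan hS ?_ ih
    have h2 : S.η (simpleRefl b θ j) =
        1 - S.x (P.root (simpleRootIdx b θ j)) • S.demazure b θ j := by
      rw [← algebraMap_smul S.Q, demazure, smul_smul, x_mul_invX, one_smul, sub_sub_cancel]
    rw [h2]
    exact sub_mem S.one_mem_demazureSpan (Submodule.smul_mem _ _ (S.demazure_mem_demazureSpan j))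

variable [Finite ι] [P.IsReduced]

/-- Every affine root is conjugate to a simple one, and conjugation by `η_w` preserves the span. -/
lemma rootDemazure_mem_demazureSpan
    (hS : ∀ i f, S.x (P.root i) ∣ f - S.act (weylGroup.ofIdx P i) f) (hθ : IsHighestRoot b θ)
    (hgen : ∀ w : AffineWeyl P, ∃ I, wordProd b θ I = w) (γ : AffineRoot P) :
    S.rootDemazure γ ∈ S.demazureSpan b θ := by
  obtain ⟨w, j, rfl⟩ := (affineSystem hθ hgen).exists_eq_smul γ
  change S.rootDemazure (w • affineSimpleRoot b θ j) ∈ _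
  rw [← η_mul_rootDemazure_mul, ← demazure_eq_rootDemazure]
  exact S.mul_mem_demazureSpan hS (S.mul_mem_demazureSpan hS (S.η_mem_demazureSpan hS hgen w)
    (S.demazure_mem_demazureSpan j)) (S.η_mem_demazureSpan hS hgen _)

lemma k_pr_demazureSeq_mem (hS : ∀ i f, S.x (P.root i) ∣ f - S.act (weylGroup.ofIdx P i) f)
    (hθ : IsHighestRoot b θ) (hgen : ∀ w : AffineWeyl P, ∃ I, wordProd b θ I = w)
    (I : List (AffineIndex b)) :
    S.k (S.pr (S.demazureSeq b θ I)) ∈ S.demazureSpan b θ := by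
  induction I with
  | nil => rw [demazureSeq_nil, k_pr_one]; exact S.one_mem_demazureSpan
  | cons j I ih =>
    rw [demazureSeq_cons, demazure_eq_rootDemazure, k_pr_rootDemazure_mul]
    have h := S.rootDemazure_mem_demazureSpan hS hθ hgen
    exact add_mem (S.mul_mem_demazureSpan hS (h _) ih) (S.mul_mem_demazureSpan hS
      (S.mul_mem_demazureSpan hS (S.η_mem_demazureSpan hS hgen _) ih) (h _))

end Span

end CoeffRing

end AffineFADA
end

/-! ### Coset representatives and the expansion -/

noncomputable section
namespace AffineFADA

namespace ReflectionSystem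

variable {W J Γ : Type*} [Group W] [MulAction W Γ] (X : ReflectionSystem W J Γ)

lemma wprod_reverse (I : List J) : X.wprod I.reverse = (X.wprod I)⁻¹ := by
  induction I with
  | nil => simp
  | cons j I ih => rw [List.reverse_cons, wprod_append, ih, wprod_cons, wprod_cons, wprod_nil,
      mul_one, mul_inv_rev, s_inv]

lemma length_inv (w : W) : X.length w⁻¹ = X.length w := by
  have h : ∀ v, X.length v⁻¹ ≤ X.length v := by
    intro v
    obtain ⟨I, rfl, hI⟩ := X.exists_reduced v
    rw [← X.wprod_reverse, ← hI, ← List.length_reverse]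
    exact X.length_wprod_le _
  exact le_antisymm (h w) (by simpa using h w⁻¹)

/-- Removing the last letter of a reduced word shortens the element, so that letter is a right
descent. -/
lemma not_pos_of_reduced_concat {I : List J} {j : J}
    (h : (I ++ [j]).length = X.length (X.wprod (I ++ [j]))) :
    ¬ X.pos (X.wprod (I ++ [j]) • X.root j) := by
  have h1 := X.length_s_mul_lt_iff j (X.wprod (I ++ [j]))⁻¹
  rw [inv_inv] at h1
  rw [← h1, X.length_inv, ← h, ← X.length_inv, mul_inv_rev, inv_inv, X.s_inv, wprod_append,
    wprod_cons, wprod_nil, mul_one, mul_assoc, X.s_mul_self, mul_one, List.length_append,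
    List.length_singleton, Nat.lt_succ_iff]
  exact X.length_wprod_le I

end ReflectionSystem

open RootPairing SkewMonoidAlgebra

variable {ι L N : Type*} [AddCommGroup L] [AddCommGroup N] {P : RootPairing ι ℤ L N}
  {b : P.Base} {θ : ι}

section Cosets

lemma eq_mul_finiteWeyl {v w : AffineWeyl P} (h : w.left = v.left) :
    w = v * finiteWeyl P (v.right⁻¹ * w.right) := by
  refine SemidirectProduct.ext ?_ ?_
  · simp [finiteWeyl, h]
  · simp [finiteWeyl]

lemma exists_minReps (b : P.Base) (θ : ι) (v : AffineWeyl P) :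
    ∃ u ∈ minReps b θ, ∃ x, v = u * finiteWeyl P x := by
  have h : ∀ x y, finiteWeyl P (x * y) = finiteWeyl P x * finiteWeyl P y :=
    map_mul SemidirectProduct.inr
  have h1 : finiteWeyl P 1 = 1 := map_one SemidirectProduct.inr
  have hy := Function.argmin_le fun y : P.weylGroup => len b θ (v * finiteWeyl P y)
  set y := Function.argmin fun y : P.weylGroup => len b θ (v * finiteWeyl P y)
  refine ⟨v * finiteWeyl P y, fun x => ?_, y⁻¹, ?_⟩
  · rw [mul_assoc, ← h]
    exact hy (y * x)
  · rw [mul_assoc, ← h, mul_inv_cancel, h1, mul_one]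

variable [Finite ι] [P.IsReduced]

/-- If the last letter were the affine node, `x` would make `α_0 = -θ + δ` negative. But a finite
element does not change the coefficient `1` of `δ`. -/
lemma finiteWeyl_last_letter (hθ : IsHighestRoot b θ)
    (hgen : ∀ w : AffineWeyl P, ∃ I, wordProd b θ I = w) {x : P.weylGroup} (hx : x ≠ 1)
    {I : List (AffineIndex b)} (hI : IsReducedSeq b θ I (finiteWeyl P x)) :
    ∃ I' i, I = I' ++ [some i] := by
  rcases List.eq_nil_or_concat I with rfl | ⟨I', j, rfl⟩
  · refine absurd (SemidirectProduct.inr_injective (hI.1.symm.trans ?_)) hx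
    rw [map_one]
    rfl
  · cases j with
    | some i => exact ⟨I', i, List.concat_eq_append⟩
    | none =>
      rw [List.concat_eq_append] at hI
      exfalso
      refine (affineSystem hθ hgen).not_pos_of_reduced_concat (I := I') (j := none)
        (hI.2.trans (congrArg (len b θ) hI.1.symm)) ?_
      change AffinePos b (wordProd b θ (I' ++ [none]) • affineSimpleRoot b θ none)
      rw [hI.1]
      left
      rw [affine_smul_snd]
      have : transl (finiteWeyl P x) = 0 := rfl
      rw [this, map_zero, sub_zero]
      exact Int.one_pos

end Cosets

namespace CoeffRing

variable (S : CoeffRing P)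

lemma zero_smul_QW (z : S.QW) : (0 : S.Q) • z = 0 := zero_smul S.Q z

lemma zero_smul_QT (z : S.QT) : (0 : S.Q) • z = 0 := zero_smul S.Q z

lemma pr_mul_η (z : S.QW) (x : P.weylGroup) : S.pr (z * S.η (finiteWeyl P x)) = S.pr z := by
  induction z using SkewMonoidAlgebra.induction_on with
  | zero => simp
  | single w p =>
    rw [η, single_mul_single, pr_single, pr_single, smul_one, mul_one]
    congr 1
    simp [finiteWeyl]
  | add y y' hy hy' => rw [add_mul, map_add, map_add, hy, hy']

/-- `pr` does not see a right factor `η_w` with `w` in the finite Weyl group, so it kills right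
multiples of `1 - η_{s_i}`. -/
lemma pr_mul_demazure (z : S.QW) (i : b.support) : S.pr (z * S.demazure b θ (some i)) = 0 := by
  induction z using SkewMonoidAlgebra.induction_on with
  | zero => simp
  | single w p =>
    have h : (single w p : S.QW) = p • S.η w := by rw [η, smul_single, smul_eq_mul, mul_one]
    rw [h, demazure, smul_mul_assoc, η_mul_smul, mul_sub, mul_one, map_smul, map_smul, map_sub]
    change _ • _ • (_ - S.pr (S.η w * S.η (finiteWeyl P _))) = _
    rw [pr_mul_η, sub_self, smul_zero, smul_zero]
  | add y y' hy hy' => rw [add_mul, map_add, hy, hy', add_zero]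

lemma pr_k (y : S.QT) : S.pr (S.k y) = y := by
  induction y using SkewMonoidAlgebra.induction_on with
  | zero => simp
  | single l p => rw [k_single, pr_single, SemidirectProduct.left_inl]
  | add y y' hy hy' => rw [map_add, map_add, hy, hy']

/-- If `v` is the only element of its coset that can lie in the support, nothing is added to its
coefficient by `pr`. -/
lemma coeff_pr_eq {z : S.QW} {v : AffineWeyl P}
    (h : ∀ w, w.left = v.left → z.coeff w ≠ 0 → w = v) : (S.pr z).coeff v.left = z.coeff v := by
  classical
  change (mapDomain _ z).coeff v.left = z.coeff v
  rw [coeff_mapDomain, Finsupp.mapDomain, Finsupp.sum_apply, Finsupp.sum,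
    Finset.sum_eq_single v]
  · rw [Finsupp.single_apply, if_pos rfl]
  · intro w hw hwv
    rw [Finsupp.single_apply, if_neg]
    exact fun hl => hwv (h w hl (Finsupp.mem_support_iff.mp hw))
  · intro hv
    rw [Finsupp.notMem_support_iff.mp hv, Finsupp.single_zero, Finsupp.zero_apply]

lemma isUnit_invX (i : ι) : IsUnit (S.invX i) :=
  IsUnit.of_mul_eq_one _ ((mul_comm _ _).trans (S.x_mul_invX i))

variable [Finite ι] [P.IsReduced] {I : AffineWeyl P → List (AffineIndex b)}

lemma pr_demazureSeq_eq_zero (hθ : IsHighestRoot b θ) (hI : IsWCompatible b θ I)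
    {v : AffineWeyl P} (hv : v ∉ minReps b θ) : S.pr (S.demazureSeq b θ (I v)) = 0 := by
  obtain ⟨u, hu, x, rfl⟩ := exists_minReps b θ v
  have hx : x ≠ 1 := by
    rintro rfl
    rw [finiteWeyl, map_one, mul_one] at hv
    exact hv hu
  obtain ⟨I', i, h⟩ := finiteWeyl_last_letter hθ (fun w => ⟨I w, (hI.reduced w).1⟩) hx
    (hI.reduced _)
  rw [hI.append u hu, h, ← List.append_assoc, demazureSeq, List.map_append, List.prod_append,
    List.map_singleton, List.prod_singleton, pr_mul_demazure]

/-- The elements `pr (X_{I_u})`, for `u` a minimal length coset representative, are linearly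
independent. -/
lemma eq_zero_of_sum_pr_eq_zero (hθ : IsHighestRoot b θ) (hI : IsWCompatible b θ I)
    (q : AffineWeyl P →₀ S.Q) (hq : ∀ v ∉ minReps b θ, q v = 0)
    (h : (q.sum fun v a => a • S.pr (S.demazureSeq b θ (I v))) = 0) : q = 0 := by
  classical
  set X := affineSystem hθ fun w => ⟨I w, (hI.reduced w).1⟩ with hX
  have hred : ∀ w, X.wprod (I w) = w ∧ (I w).length = X.length w := hI.reduced
  by_contra hne
  obtain ⟨v, hv, hmax⟩ := q.support.exists_max_image X.length (Finsupp.support_nonempty_iff.mpr hne)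
  have hmin : ∀ {w}, w ∈ q.support → w ∈ minReps b θ := fun {w} hw => by
    by_contra hw'
    exact Finsupp.mem_support_iff.mp hw (hq w hw')
  -- Let `w` lie in the coset of `v` and in the support of `X_{I_{v'}}`. If `w ≠ v'` then `w` is
  -- shorter than `v'`, hence than the longest `v`, contradicting minimality of `v` in its coset. So
  -- `w = v'`, no longer than `v`.
  have key : ∀ v' ∈ q.support, ∀ w, w.left = v.left →
      (S.demazureSeq b θ (I v')).coeff w ≠ 0 → v' = v ∧ w = v := by
    intro v' hv' w hw hc
    have h1 := eq_mul_finiteWeyl hw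
    have h2 : X.length v ≤ X.length w := by
      rw [h1]
      exact hmin hv _
    have h3 : w = v' := by
      rcases X.eq_or_length_lt_of_coeff_ne_zero _ (I v') hc with h3 | h3
      · rw [h3, (hred v').1]
      · rw [(hred v').2] at h3
        have := hmax v' hv'
        omega
    subst h3
    -- Compatibility of the words makes lengths add along `w = v x`, so the finite factor `x` has
    -- length zero.
    have h4 : X.length w = X.length v + X.length (finiteWeyl P (v.right⁻¹ * w.right)) := by
      conv_lhs => rw [h1]
      rw [← (hred _).2, hI.append v (hmin hv), List.length_append, (hred _).2, (hred _).2]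
    have h5 := hmax w hv'
    have h6 : finiteWeyl P (v.right⁻¹ * w.right) = 1 :=
      X.eq_one_of_length_eq_zero (by omega)
    rw [h6, mul_one] at h1
    exact ⟨h1, h1⟩
  have h1 : ∀ v' ∈ q.support, (S.pr (S.demazureSeq b θ (I v'))).coeff v.left =
      (S.demazureSeq b θ (I v')).coeff v := fun v' hv' =>
    S.coeff_pr_eq fun w hw hc => (key v' hv' w hw hc).2
  have h2 := DFunLike.congr_fun (congrArg coeffAddEquiv h) v.left
  rw [Finsupp.sum, _root_.map_sum, Finsupp.finsetSum_apply, Finset.sum_eq_single v] at h2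
  · change q v * (S.pr (S.demazureSeq b θ (I v))).coeff v.left = 0 at h2
    rw [h1 v hv] at h2
    have h3 : (S.demazureSeq b θ (I v)).coeff v =
        X.leadCoeff (fun j => S.invX (simpleRootIdx b θ j)) (I v) := by
      have h4 := X.coeff_demSeq_wprod (fun j => S.invX (simpleRootIdx b θ j)) (I v)
        (by rw [(hred v).1, (hred v).2])
      rwa [(hred v).1] at h4
    rw [h3, (X.isUnit_leadCoeff _ (fun j => S.isUnit_invX _) (I v)).mul_left_eq_zero] at h2
    exact Finsupp.mem_support_iff.mp hv h2
  · intro v' hv' hne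
    change q v' * (S.pr (S.demazureSeq b θ (I v'))).coeff v.left = 0
    rw [h1 v' hv', by_contra fun h => hne (key v' hv' v rfl h).1, mul_zero]
  · exact fun h => absurd hv h

/-- The expansion of `k (pr X_{I_u})`, for a coefficient ring that is a specialization of a model
over the affine root lattice. -/
theorem exists_k_pr_expansion (M : LatticeModel (AffineLattice P)) [IsDomain M.carrier]
    (hx : ∀ μ, μ ≠ 0 → M.x μ ≠ 0) (φ : M.carrier →+* S.carrier)
    (hφx : ∀ μ, φ (M.x μ) = S.x μ.1)
    (hφ : ∀ (w : AffineWeyl P) p, φ (M.map (affineEnd w) p) = S.act w.right (φ p))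
    (hS : ∀ i f, S.x (P.root i) ∣ f - S.act (weylGroup.ofIdx P i) f)
    (hθ : IsHighestRoot b θ) (hI : IsWCompatible b θ I) (u : AffineWeyl P) :
    ∃ c : AffineWeyl P →₀ S.carrier, (∀ v ∈ minReps b θ, c v = 0) ∧
      S.k (S.pr (S.demazureSeq b θ (I u))) = S.demazureSeq b θ (I u) +
        c.sum fun v a => algebraMap _ S.Q a • S.demazureSeq b θ (I v) := by
  classical
  have hgen : ∀ w : AffineWeyl P, ∃ I, wordProd b θ I = w := fun w => ⟨I w, (hI.reduced w).1⟩
  have hspan : S.demazureSpan b θ ≤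
      Submodule.span S.carrier (Set.range fun w => S.demazureSeq b θ (I w)) := by
    refine Submodule.span_le.mpr ?_
    rintro _ ⟨I', rfl⟩
    exact S.demazureSeq_mem_span hθ hgen M hx φ hφx hφ hI.reduced I'
  have h1 : S.k (S.pr (S.demazureSeq b θ (I u))) - S.demazureSeq b θ (I u) ∈
      Submodule.span S.carrier (Set.range fun w => S.demazureSeq b θ (I w)) :=
    hspan (sub_mem (S.k_pr_demazureSeq_mem hS hθ hgen _) (Submodule.subset_span ⟨_, rfl⟩))
  obtain ⟨c, hc⟩ := (Finsupp.mem_span_range_iff_exists_finsupp).mp h1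
  have hc' : (c.sum fun v a => algebraMap _ S.Q a • S.demazureSeq b θ (I v)) =
      S.k (S.pr (S.demazureSeq b θ (I u))) - S.demazureSeq b θ (I u) := by
    rw [← hc]
    simp only [algebraMap_smul]
  set p : AffineWeyl P → Prop := fun v => v ∈ minReps b θ with hp
  have hadd : ∀ d d' : AffineWeyl P →₀ S.carrier,
      ((d + d').sum fun v a => algebraMap _ S.Q a • S.demazureSeq b θ (I v)) =
      (d.sum fun v a => algebraMap _ S.Q a • S.demazureSeq b θ (I v)) +
        d'.sum fun v a => algebraMap _ S.Q a • S.demazureSeq b θ (I v) := fun d d' =>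
    Finsupp.sum_add_index' (fun v => by rw [map_zero]; exact S.zero_smul_QW _)
      fun v a a' => by rw [map_add, add_smul]
  have hsplit := hadd (c.filter p) (c.filter fun v => ¬ p v)
  rw [Finsupp.filter_add_filter_not, hc'] at hsplit
  -- Apply `pr` to the expansion: the left side and the terms at non-minimal `v` vanish, and
  -- independence finishes.
  have h2 : (c.filter p).mapRange (algebraMap S.carrier S.Q) (map_zero _) = 0 := by
    refine S.eq_zero_of_sum_pr_eq_zero hθ hI _ (fun v hv => ?_) ?_
    · rw [Finsupp.mapRange_apply, Finsupp.filter_apply_neg p c hv, map_zero]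
    · have h3 := congrArg S.pr hsplit
      rw [map_sub, pr_k, sub_self, map_add, map_finsuppSum, map_finsuppSum] at h3
      have h4 := Finsupp.sum_mapRange_index (f := algebraMap S.carrier S.Q) (hf := map_zero _)
        (g := c.filter p) (h := fun v a => a • S.pr (S.demazureSeq b θ (I v)))
        fun v => S.zero_smul_QT _
      rw [h4]
      rw [add_eq_left.mpr] at h3
      · rw [h3]
        exact Finset.sum_congr rfl fun v _ => (map_smul S.pr _ _).symm
      · refine Finset.sum_eq_zero fun v hv => ?_
        rw [Finsupp.support_filter, Finset.mem_filter] at hv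
        change S.pr (_ • S.demazureSeq b θ (I v)) = 0
        rw [map_smul, S.pr_demazureSeq_eq_zero hθ hI hv.2, smul_zero]
  refine ⟨c.filter fun v => ¬ p v, fun v hv => Finsupp.filter_apply_neg _ c (not_not.mpr hv), ?_⟩
  -- The coefficients at minimal `v` are known to vanish in `Q` only. They are therefore discarded
  -- from `c`, and injectivity of `S → Q` is not needed.
  have h4 : ((c.filter p).sum fun v a => algebraMap _ S.Q a • S.demazureSeq b θ (I v)) = 0 :=
    Finset.sum_eq_zero fun v _ => by
      have h5 : algebraMap S.carrier S.Q (c.filter p v) = 0 := DFunLike.congr_fun h2 v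
      change algebraMap S.carrier S.Q (c.filter p v) • _ = _
      rw [h5]
      exact S.zero_smul_QW _
  rw [h4, zero_add] at hsplit
  rw [← hsplit, add_sub_cancel]

end CoeffRing

end AffineFADA
end

/-! ### The formal group algebra -/

noncomputable section
namespace AffineFADA

open MvPowerSeries

section

variable {σ R : Type*} [Finite σ] [CommRing R]

lemma hasSubst_kill [DecidableEq σ] (k : σ) :
    HasSubst fun i => if i = k then (0 : MvPowerSeries σ R) else X i :=
  hasSubst_of_constantCoeff_zero fun i => by split_ifs <;> simp

lemma coeff_subst_kill [DecidableEq σ] (k : σ) (p : MvPowerSeries σ R) {d : σ →₀ ℕ}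
    (hd : d k = 0) :
    coeff d (subst (fun i => if i = k then (0 : MvPowerSeries σ R) else X i) p) = coeff d p := by
  have hprod : ∀ m : σ →₀ ℕ, m k = 0 →
      (m.prod fun s n => (if s = k then (0 : MvPowerSeries σ R) else X s) ^ n) =
        monomial m 1 := by
    intro m hm
    rw [monomial_one_eq]
    refine Finsupp.prod_congr fun s hs => ?_
    rw [if_neg]
    rintro rfl
    exact Finsupp.mem_support_iff.mp hs hm
  rw [coeff_subst (hasSubst_kill k), finsum_eq_single _ d]
  · rw [hprod d hd, coeff_monomial_same, smul_eq_mul, mul_one]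
  · intro m hm
    by_cases hmk : m k = 0
    · rw [hprod m hmk, coeff_monomial_ne (Ne.symm hm), smul_zero]
    · rw [Finsupp.prod, Finset.prod_eq_zero (Finsupp.mem_support_iff.mpr hmk), map_zero, smul_zero]
      rw [if_pos rfl, zero_pow hmk]

lemma X_dvd_of_subst_kill [DecidableEq σ] {k : σ} {p : MvPowerSeries σ R}
    (h : subst (fun i => if i = k then (0 : MvPowerSeries σ R) else X i) p = 0) : X k ∣ p := by
  rw [X_dvd_iff]
  intro d hd
  rw [← coeff_subst_kill k p hd, h, map_zero]

end

section

variable {R : Type*} [CommRing R] [IsDomain R] (F : FormalGroup R)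

/-- `F(x, 0) = x` and `F(0, y) = y` make `F - x - y` vanish on both axes, hence divisible by `y` and
then by `x`. -/
lemma exists_toPowerSeries_eq :
    ∃ G, F.toPowerSeries = X 0 + X 1 + X 0 * X 1 * G := by
  classical
  have e1 : (fun i : Fin 2 => if i = 1 then (0 : MvPowerSeries (Fin 2) R) else X i) =
      ![X 0, 0] := by
    ext1 i; fin_cases i <;> simp
  have e0 : (fun i : Fin 2 => if i = 0 then (0 : MvPowerSeries (Fin 2) R) else X i) =
      ![0, X 1] := by
    ext1 i; fin_cases i <;> simp
  have s1 := hasSubst_kill (R := R) (1 : Fin 2)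
  have s0 := hasSubst_kill (R := R) (0 : Fin 2)
  have h1 : (X 1 : MvPowerSeries (Fin 2) R) ∣ F.toPowerSeries - (X 0 + X 1) := by
    refine X_dvd_of_subst_kill ?_
    rw [subst_sub s1, subst_add s1, subst_X s1, subst_X s1, e1,
      F.add_zero (PowerSeries.HasSubst.X 0)]
    simp
  obtain ⟨g, hg⟩ := h1
  have h0 : (X 0 : MvPowerSeries (Fin 2) R) ∣ g := by
    refine X_dvd_of_subst_kill ?_
    have h := congrArg (subst fun i : Fin 2 =>
      if i = 0 then (0 : MvPowerSeries (Fin 2) R) else X i) hg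
    rw [subst_sub s0, subst_add s0, subst_mul s0, subst_X s0, subst_X s0] at h
    conv_lhs at h => rw [e0, F.zero_add (PowerSeries.HasSubst.X 1)]
    simp only [if_pos, one_ne_zero, if_false, zero_add, sub_self] at h
    refine (mul_eq_zero.mp h.symm).resolve_left fun h => ?_
    have h' := congrArg (coeff (Finsupp.single 1 1)) h
    rw [coeff_index_single_self_X, map_zero] at h'
    exact one_ne_zero h'
  obtain ⟨g', rfl⟩ := h0
  exact ⟨g', by linear_combination hg⟩

lemma exists_subst_eq {σ : Type*} {f g : MvPowerSeries σ R} (hf : PowerSeries.HasSubst f)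
    (hg : PowerSeries.HasSubst g) :
    ∃ p, F.toPowerSeries.subst ![f, g] = f + g + f * g * p := by
  obtain ⟨G, hG⟩ := exists_toPowerSeries_eq F
  have h : HasSubst ![f, g] :=
    hasSubst_of_constantCoeff_nilpotent (by intro s; fin_cases s; exacts [hf, hg])
  refine ⟨subst ![f, g] G, ?_⟩
  rw [hG, subst_add h, subst_add h, subst_mul h, subst_mul h, subst_X h, subst_X h]
  simp

variable [F.IsComm] {L L' L'' : Type*} [AddCommGroup L] [AddCommGroup L'] [AddCommGroup L'']
  {κ κ' κ'' : Type*} [Finite κ] [Finite κ'] [Finite κ'']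
  (e : Module.Basis κ ℤ L) (e' : Module.Basis κ' ℤ L') (e'' : Module.Basis κ'' ℤ L'')

omit [IsDomain R] [Finite κ'] in
lemma hasSubst_fgaVar_hom (g : L →+ L') : HasSubst fun i => fgaVar F e' (g (e i)) :=
  hasSubst_of_constantCoeff_nilpotent fun i => hasSubst_fgaVar F e' (g (e i))

/-- The homomorphism of formal group algebras induced by a homomorphism of lattices. -/
def fgaHom (g : L →+ L') : MvPowerSeries κ R →ₐ[R] MvPowerSeries κ' R :=
  substAlgHom (hasSubst_fgaVar_hom F e e' g)

omit [IsDomain R] [Finite κ'] in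
lemma fgaHom_X (g : L →+ L') (i : κ) : fgaHom F e e' g (X i) = fgaVar F e' (g (e i)) :=
  substAlgHom_X _ i

omit [IsDomain R] [Finite κ'] in
lemma fgaHom_subst (g : L →+ L') {p q : MvPowerSeries κ R} (hp : PowerSeries.HasSubst p)
    (hq : PowerSeries.HasSubst q) :
    fgaHom F e e' g (F.toPowerSeries.subst ![p, q]) =
      F.toPowerSeries.subst ![fgaHom F e e' g p, fgaHom F e e' g q] := by
  have h : HasSubst ![p, q] :=
    hasSubst_of_constantCoeff_nilpotent (by intro s; fin_cases s <;> simpa)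
  rw [fgaHom, coe_substAlgHom, subst_comp_subst_apply h (hasSubst_fgaVar_hom F e e' g)]
  congr 1
  ext1 s
  fin_cases s <;> rfl

omit [IsDomain R] [Finite κ'] in
lemma fgaHom_var (g : L →+ L') (μ : L) :
    fgaHom F e e' g (fgaVar F e μ) = fgaVar F e' (g μ) := by
  let T : F.Point κ →+ F.Point κ' :=
    { toFun := fun p => ⟨fgaHom F e e' g p.val,
        IsNilpotent_substAlgHom (hasSubst_fgaVar_hom F e e' g) p.prop⟩
      map_zero' := Subtype.ext (map_zero (fgaHom F e e' g))
      map_add' := fun p q => Subtype.ext (fgaHom_subst F e e' g p.prop q.prop) }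
  have h : T.toIntLinearMap ∘ₗ fgaPoint F e = fgaPoint F e' ∘ₗ g.toIntLinearMap := by
    refine e.ext fun i => Subtype.ext ?_
    change fgaHom F e e' g (fgaVar F e (e i)) = fgaVar F e' (g (e i))
    rw [fgaVar_basis, fgaHom_X]
  exact congrArg Subtype.val (LinearMap.congr_fun h μ)

omit [IsDomain R] [Finite κ''] in
lemma fgaHom_comp (g : L' →+ L'') (h : L →+ L') (p : MvPowerSeries κ R) :
    fgaHom F e e'' (g.comp h) p = fgaHom F e' e'' g (fgaHom F e e' h p) := by
  simp only [fgaHom, coe_substAlgHom]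
  rw [subst_comp_subst_apply (hasSubst_fgaVar_hom F e e' h) (hasSubst_fgaVar_hom F e' e'' g)]
  congr 1
  ext1 i
  rw [← coe_substAlgHom (hasSubst_fgaVar_hom F e' e'' g)]
  exact (fgaHom_var F e' e'' g (h (e i))).symm

omit [IsDomain R] in
lemma fgaHom_eq_fgaMap (g : L →+ L) : fgaHom F e e g = fgaMap F e g := rfl

omit [IsDomain R] in
lemma fgaHom_id (p : MvPowerSeries κ R) : fgaHom F e e (AddMonoidHom.id L) p = p := by
  rw [fgaHom_eq_fgaMap, fgaMap_id]
  rfl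

omit [Finite κ] in
lemma fgaVar_mul_dvd_add (μ : L) :
    fgaVar F e μ * fgaVar F e (-μ) ∣ fgaVar F e μ + fgaVar F e (-μ) := by
  obtain ⟨p, hp⟩ := exists_subst_eq F (hasSubst_fgaVar F e μ) (hasSubst_fgaVar F e (-μ))
  rw [← fgaVar_add, add_neg_cancel, fgaVar_zero] at hp
  exact ⟨-p, by linear_combination -hp⟩

omit [IsDomain R] in
-- Reduction to a universal case over `L × ℤ`, where the new direction has its own variable `t`. The
-- lifts `μ ↦ (μ, 0)` and `μ ↦ (μ, m μ)` agree after `t ↦ 0`, so their difference is divisible by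
-- `t`. The map `(μ, k) ↦ μ + k γ` then turns the lifts into the identity and `g`, and `t` into
-- `x_γ`.
lemma fgaVar_dvd_sub_map {γ : L} {g : L →+ L} (hg : ∀ μ, ∃ k : ℤ, g μ = μ + k • γ)
    (p : MvPowerSeries κ R) : fgaVar F e γ ∣ p - fgaMap F e g p := by
  classical
  choose k hk using fun i => hg (e i)
  let m : L →ₗ[ℤ] ℤ := e.constr ℤ k
  have hm : ∀ μ, g μ = μ + m μ • γ := by
    have h : g.toIntLinearMap = LinearMap.id + m.smulRight γ := by
      refine e.ext fun i => ?_
      simp [m, hk, Module.Basis.constr_basis]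
    exact fun μ => LinearMap.congr_fun h μ
  let E : Module.Basis (κ ⊕ Unit) ℤ (L × ℤ) := e.prod (Module.Basis.singleton Unit ℤ)
  have hE : E (Sum.inr ()) = (0, 1) := by simp [E]
  have hE' : ∀ i, E (Sum.inl i) = (e i, 0) := fun i => by simp [E]
  let A₀ : L →+ L × ℤ := AddMonoidHom.inl L ℤ
  let A : L →+ L × ℤ := (AddMonoidHom.id L).prod m.toAddMonoidHom
  let B : L × ℤ →+ L := (AddMonoidHom.id L).coprod (zmultiplesHom L γ)
  let C : L × ℤ →+ L × ℤ := A₀.comp (AddMonoidHom.fst L ℤ)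
  have hC : fgaHom F e E (C.comp A₀) p = fgaHom F e E (C.comp A) p := by
    have h : C.comp A₀ = C.comp A := by ext <;> rfl
    rw [h]
  rw [fgaHom_comp F e E E, fgaHom_comp F e E E, ← sub_eq_zero, ← map_sub] at hC
  have hfun : (fun i : κ ⊕ Unit =>
      if i = Sum.inr () then (0 : MvPowerSeries (κ ⊕ Unit) R) else X i) =
      fun i => fgaVar F E (C (E i)) := by
    ext1 i
    rcases i with i | i
    · have h : C (E (Sum.inl i)) = E (Sum.inl i) := by
        rw [hE']
        rfl
      rw [h, fgaVar_basis, if_neg Sum.inl_ne_inr]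
    · have h : C (E (Sum.inr i)) = 0 := by
        rw [hE]
        rfl
      rw [h, fgaVar_zero, if_pos rfl]
  have hX : X (Sum.inr ()) ∣ fgaHom F e E A₀ p - fgaHom F e E A p := by
    refine X_dvd_of_subst_kill ?_
    rw [hfun, ← coe_substAlgHom (hasSubst_fgaVar_hom F E E C)]
    exact hC
  have h := map_dvd (fgaHom F E e B) hX
  have hB₀ : B.comp A₀ = AddMonoidHom.id L := by
    ext μ
    simp [A₀, B]
  have hB : B.comp A = g := by
    ext μ
    simp [A, B, hm]
  rwa [fgaHom_X, hE, map_sub, ← fgaHom_comp, ← fgaHom_comp, hB₀, hB, fgaHom_id,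
    fgaHom_eq_fgaMap, show B (0, 1) = γ by simp [B]] at h

omit [Finite κ] in
-- The linear part of `x_μ` is `μ` itself, since `F` is addition up to terms of order two. In
-- characteristic zero this gives `x_μ ≠ 0` for `μ ≠ 0`.
lemma coeff_single_fgaVar (i : κ) (μ : L) :
    coeff (Finsupp.single i 1) (fgaVar F e μ) = (e.repr μ i : R) := by
  classical
  let T : F.Point κ →+ R :=
    { toFun := fun p => coeff (Finsupp.single i 1) p.val
      map_zero' := by simp
      map_add' := fun p q => by
        obtain ⟨r, hr⟩ := exists_subst_eq F p.prop q.prop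
        have hp : constantCoeff p.val = 0 := IsNilpotent.eq_zero p.prop
        have hq : constantCoeff q.val = 0 := IsNilpotent.eq_zero q.prop
        rw [FormalGroup.add_apply, hr, map_add, map_add, add_eq_left]
        refine coeff_of_lt_order (lt_of_lt_of_le ?_ (le_order_mul.trans' (add_le_add
          (le_order_mul.trans' (add_le_add (one_le_order_iff_constCoeff_eq_zero.mpr hp)
            (one_le_order_iff_constCoeff_eq_zero.mpr hq))) bot_le)))
        rw [Finsupp.degree_single]
        exact ENat.natCast_lt_natCast.mpr one_lt_two }
  have h : T.toIntLinearMap ∘ₗ fgaPoint F e =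
      (Int.castAddHom R).toIntLinearMap ∘ₗ e.coord i := by
    refine e.ext fun j => ?_
    change coeff (Finsupp.single i 1) (fgaVar F e (e j)) = ((e.repr (e j) i : ℤ) : R)
    rw [fgaVar_basis, e.repr_self, coeff_index_single_X, Finsupp.single_apply]
    simp [eq_comm]
  exact LinearMap.congr_fun h μ

omit [Finite κ] in
lemma fgaVar_ne_zero [CharZero R] {μ : L} (hμ : μ ≠ 0) : fgaVar F e μ ≠ 0 := by
  intro h
  refine hμ (e.ext_elem fun i => ?_)
  have h1 := coeff_single_fgaVar F e i μ
  rw [h, map_zero] at h1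
  rw [map_zero, Finsupp.zero_apply]
  exact_mod_cast h1.symm

/-- The formal group algebra of a lattice. -/
def powerSeriesModel : LatticeModel L where
  carrier := MvPowerSeries κ R
  x := fgaVar F e
  map g := (fgaMap F e g).toRingHom
  map_x := fgaMap_var F e
  map_id := by rw [fgaMap_id]; rfl
  map_comp g h := by rw [fgaMap_comp]; rfl
  x_zero := fgaVar_zero F e
  mul_dvd_add := fgaVar_mul_dvd_add F e
  dvd_sub_map _ _ hg p := fgaVar_dvd_sub_map F e hg p

instance : IsDomain (powerSeriesModel F e).carrier :=
  NoZeroDivisors.to_isDomain (MvPowerSeries κ R)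

end

section

open RootPairing

variable {ι L N : Type*} [AddCommGroup L] [AddCommGroup N] {P : RootPairing ι ℤ L N} {b : P.Base} {θ : ι} {I : AffineWeyl P → List (AffineIndex b)}
  {R : Type*} [CommRing R] [IsDomain R] [CharZero R]

/-- The projection of the affine root lattice to the character lattice. -/
def forgetDelta (P : RootPairing ι ℤ L N) : AffineLattice P →+ L :=
  (P.rootSpan ℤ).subtype.toAddMonoidHom.comp (AddMonoidHom.fst _ _)

lemma forgetDelta_comp_affineEnd (w : AffineWeyl P) :
    (forgetDelta P).comp (affineEnd w) =
      (DistribSMul.toAddMonoidHom L w.right).comp (forgetDelta P) := rfl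

/-- A basis of the affine root lattice. -/
def affineBasis (b : P.Base) : Module.Basis (b.support ⊕ Unit) ℤ (AffineLattice P) :=
  b.toWeightBasisInt.prod (Module.Basis.singleton Unit ℤ)

theorem powerSeriesRing_expansion [Finite ι] [P.IsReduced] (F : FormalGroup R) [F.IsComm] {κ : Type*} [Finite κ]
    (e : Module.Basis κ ℤ L) (hθ : IsHighestRoot b θ) (hI : IsWCompatible b θ I)
    (u : AffineWeyl P) :
    ∃ c : AffineWeyl P →₀ (powerSeriesRing P F e).carrier, (∀ v ∈ minReps b θ, c v = 0) ∧
      (powerSeriesRing P F e).k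
          ((powerSeriesRing P F e).pr ((powerSeriesRing P F e).demazureSeq b θ (I u))) =
        (powerSeriesRing P F e).demazureSeq b θ (I u) +
          c.sum fun v a => algebraMap _ (powerSeriesRing P F e).Q a •
            (powerSeriesRing P F e).demazureSeq b θ (I v) := by
  refine (powerSeriesRing P F e).exists_k_pr_expansion (powerSeriesModel F (affineBasis b))
    (fun μ hμ => fgaVar_ne_zero F (affineBasis b) hμ)
    (fgaHom F (affineBasis b) e (forgetDelta P)).toRingHom
    (fun μ => fgaHom_var F (affineBasis b) e (forgetDelta P) μ) (fun w p => ?_) (fun i f => ?_)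
    hθ hI u
  · refine (fgaHom_comp F (affineBasis b) (affineBasis b) e (forgetDelta P) _ p).symm.trans ?_
    rw [forgetDelta_comp_affineEnd]
    exact fgaHom_comp F (affineBasis b) e e (DistribSMul.toAddMonoidHom L w.right) _ p
  · exact fgaVar_dvd_sub_map F e (fun μ => ⟨-P.toLinearMap μ (P.coroot i),
      (ofIdx_smul_eq P i μ).trans (by rw [neg_smul, sub_eq_add_neg])⟩) f

end

end AffineFADA
end

/-! ### The polynomial formal group algebra -/

noncomputable section
namespace AffineFADA

section

variable {R : Type*} [CommRing R] (q : R)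

open MvPowerSeries in
/-- The formal group law `x + y - q x y`. -/
def connectiveGroup : FormalGroup R where
  toPowerSeries := X 0 + X 1 - C q * (X 0 * X 1)
  zero_constantCoeff := by simp
  lin_coeff_X := by
    simp [X, monomial_mul_monomial, coeff_monomial,
      Finsupp.single_left_inj (one_ne_zero : (1 : ℕ) ≠ 0)]
  lin_coeff_Y := by
    simp [X, monomial_mul_monomial, coeff_monomial,
      Finsupp.single_left_inj (one_ne_zero : (1 : ℕ) ≠ 0)]
  assoc := by
    have aux₁ := HasSubst.cons_subst_zero_left
      (f := (X 0 + X 1 - C q * (X 0 * X 1) : MvPowerSeries (Fin 2) R)) (0 : Fin 3) 1 2 (by simp)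
    have aux₂ := HasSubst.cons_subst_zero_right
      (f := (X 0 + X 1 - C q * (X 0 * X 1) : MvPowerSeries (Fin 2) R)) (0 : Fin 3) 1 2 (by simp)
    simp_rw [subst_sub aux₁, subst_add aux₁, subst_mul aux₁, subst_X aux₁, subst_sub aux₂,
      subst_add aux₂, subst_mul aux₂, subst_X aux₂]
    simp only [Nat.succ_eq_add_one, Nat.reduceAdd, subst_sub .X_X, subst_add .X_X, Fin.isValue,
      subst_X .X_X, Matrix.cons_val_zero, Matrix.cons_val_one, Matrix.cons_val_fin_one,
      subst_mul .X_X, subst_C]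
    ring

open MvPowerSeries in
lemma connectiveGroup_subst {σ : Type*} {f g : MvPowerSeries σ R} (hf : PowerSeries.HasSubst f)
    (hg : PowerSeries.HasSubst g) :
    (connectiveGroup q).toPowerSeries.subst ![f, g] = f + g - C q * (f * g) := by
  have h : HasSubst ![f, g] :=
    hasSubst_of_constantCoeff_nilpotent (by intro s; fin_cases s; exacts [hf, hg])
  rw [connectiveGroup, subst_sub h, subst_add h, subst_mul h, subst_mul h, subst_X h, subst_X h,
    subst_C]
  simp

instance : (connectiveGroup q).IsComm where
  comm := by
    rw [connectiveGroup_subst q (PowerSeries.HasSubst.X _) (PowerSeries.HasSubst.X _)]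
    simp only [connectiveGroup]
    ring

variable {L L' L'' : Type*} [AddCommGroup L] [AddCommGroup L'] [AddCommGroup L'']

lemma connVar_zero : connVar q (0 : L) = 0 :=
  Ideal.Quotient.eq_zero_iff_mem.mpr (Ideal.subset_span (Or.inl rfl))

lemma connVar_add (μ ν : L) : connVar q (μ + ν) =
    connVar q μ + connVar q ν - algebraMap R _ q * connVar q μ * connVar q ν :=
  Ideal.Quotient.eq.mpr (Ideal.subset_span (Or.inr ⟨(μ, ν), rfl⟩))

lemma connVar_add_neg (μ : L) :
    connVar q μ + connVar q (-μ) = algebraMap R _ q * connVar q μ * connVar q (-μ) := by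
  rw [← sub_eq_zero, ← connVar_add, add_neg_cancel, connVar_zero]

lemma conn_ringHom_ext {B : Type*} [Semiring B] {f g : ConnAlgebra q L →+* B}
    (h : ∀ r, f (algebraMap R _ r) = g (algebraMap R _ r))
    (h' : ∀ μ, f (connVar q μ) = g (connVar q μ)) : f = g :=
  Ideal.Quotient.ringHom_ext (MvPolynomial.ringHom_ext h h')

/-- The homomorphism induced by a homomorphism of lattices. -/
def connHom (g : L →+ L') : ConnAlgebra q L →+* ConnAlgebra q L' :=
  Ideal.quotientMap _ (MvPolynomial.rename (R := R) g).toRingHom (by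
    rw [connIdeal, Ideal.span_le]
    rintro _ (rfl | ⟨⟨μ, ν⟩, rfl⟩)
    · refine Ideal.subset_span (Or.inl ?_)
      simp
    · refine Ideal.subset_span (Or.inr ⟨(g μ, g ν), ?_⟩)
      simp)

lemma connHom_var (g : L →+ L') (μ : L) : connHom q g (connVar q μ) = connVar q (g μ) := by
  simp [connHom, connVar]

lemma connHom_algebraMap (g : L →+ L') (r : R) :
    connHom q g (algebraMap R _ r) = algebraMap R _ r := by
  change Ideal.Quotient.mk _ (MvPolynomial.rename g (MvPolynomial.C r)) = _
  rw [MvPolynomial.rename_C]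
  rfl

lemma connHom_comp (g : L' →+ L'') (h : L →+ L') :
    connHom q (g.comp h) = (connHom q g).comp (connHom q h) :=
  conn_ringHom_ext q (fun r => by simp only [RingHom.comp_apply, connHom_algebraMap])
    fun μ => by simp only [RingHom.comp_apply, connHom_var, AddMonoidHom.comp_apply]

lemma connHom_id : connHom q (AddMonoidHom.id L) = RingHom.id _ :=
  conn_ringHom_ext q (fun r => by rw [connHom_algebraMap, RingHom.id_apply])
    fun μ => by rw [connHom_var, RingHom.id_apply, AddMonoidHom.id_apply]

lemma connVar_dvd_neg (μ : L) : connVar q μ ∣ connVar q (-μ) :=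
  ⟨algebraMap R _ q * connVar q (-μ) - 1, by linear_combination connVar_add_neg q μ⟩

lemma connVar_dvd_zsmul (μ : L) (k : ℤ) : connVar q μ ∣ connVar q (k • μ) := by
  have h : ∀ n : ℕ, connVar q μ ∣ connVar q (n • μ) := by
    intro n
    induction n with
    | zero => rw [zero_smul, connVar_zero]; exact dvd_zero _
    | succ n ih =>
      rw [succ_nsmul, connVar_add]
      exact dvd_sub (dvd_add ih dvd_rfl) (Dvd.intro_left _ rfl)
  obtain ⟨n, rfl | rfl⟩ := k.eq_nat_or_neg
  · rw [natCast_zsmul]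
    exact h n
  · rw [neg_smul, natCast_zsmul]
    exact (h n).trans (connVar_dvd_neg q _)

/-- Modulo `x_γ` the two maps are ring homomorphisms, so agreement on the generators suffices. -/
lemma connVar_dvd_sub_map {γ : L} {g : L →+ L} (hg : ∀ μ, ∃ k : ℤ, g μ = μ + k • γ)
    (p : ConnAlgebra q L) : connVar q γ ∣ p - connHom q g p := by
  have h : Ideal.Quotient.mk (Ideal.span {connVar q γ}) =
      (Ideal.Quotient.mk (Ideal.span {connVar q γ})).comp (connHom q g) := by
    refine conn_ringHom_ext q (fun r => ?_) fun μ => ?_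
    · rw [RingHom.comp_apply, connHom_algebraMap]
    · obtain ⟨k, hk⟩ := hg μ
      obtain ⟨c, hc⟩ := connVar_dvd_zsmul q γ k
      rw [RingHom.comp_apply, connHom_var, hk, Ideal.Quotient.eq, Ideal.mem_span_singleton,
        connVar_add, hc]
      exact ⟨c * (algebraMap R _ q * connVar q μ - 1), by ring⟩
  rw [← Ideal.mem_span_singleton, ← Ideal.Quotient.eq]
  exact RingHom.congr_fun h p

variable {κ : Type*} (e : Module.Basis κ ℤ L)

/-- The comparison map to the formal group algebra. -/
def connToSeries : ConnAlgebra q L →+* MvPowerSeries κ R :=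
  Ideal.Quotient.lift _
    (MvPolynomial.aeval (R := R) (fgaVar (connectiveGroup q) e)).toRingHom (by
      suffices h : connIdeal q L ≤ RingHom.ker
          (MvPolynomial.aeval (R := R) (fgaVar (connectiveGroup q) e)).toRingHom from
        fun a ha => h ha
      rw [connIdeal, Ideal.span_le]
      rintro _ (rfl | ⟨⟨μ, ν⟩, rfl⟩)
      · change MvPolynomial.aeval _ (MvPolynomial.X 0) = 0
        rw [MvPolynomial.aeval_X, fgaVar_zero]
      · change MvPolynomial.aeval _ _ = 0
        simp only [map_sub, map_add, map_mul, MvPolynomial.aeval_X, MvPolynomial.aeval_C,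
          fgaVar_add, connectiveGroup_subst q (hasSubst_fgaVar _ e μ) (hasSubst_fgaVar _ e ν)]
        rw [MvPowerSeries.algebraMap_apply, Algebra.algebraMap_self, RingHom.id_apply]
        ring)

lemma connToSeries_var (μ : L) :
    connToSeries q e (connVar q μ) = fgaVar (connectiveGroup q) e μ := by
  change MvPolynomial.aeval _ (MvPolynomial.X μ) = _
  rw [MvPolynomial.aeval_X]

lemma connToSeries_algebraMap (r : R) :
    connToSeries q e (algebraMap R _ r) = algebraMap R _ r := by
  change MvPolynomial.aeval _ (MvPolynomial.C r) = _
  rw [MvPolynomial.aeval_C]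

/-- The map from the polynomial ring on a basis. -/
def polyToConn : MvPolynomial κ R →ₐ[R] ConnAlgebra q L :=
  MvPolynomial.aeval fun i => connVar q (e i)

lemma connToSeries_polyToConn (p : MvPolynomial κ R) :
    connToSeries q e (polyToConn q e p) = (p : MvPowerSeries κ R) := by
  induction p using MvPolynomial.induction_on with
  | C r =>
    rw [polyToConn, MvPolynomial.aeval_C, connToSeries_algebraMap, MvPolynomial.coe_C]
    rfl
  | add p p' hp hp' => rw [map_add, map_add, hp, hp', MvPolynomial.coe_add]
  | mul_X p i hp =>
    rw [map_mul, map_mul, hp, MvPolynomial.coe_mul, polyToConn, MvPolynomial.aeval_X,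
      connToSeries_var, fgaVar_basis, MvPolynomial.coe_X]

variable [Fintype κ]

/-- The product of the `1 - q x_i` over a basis. -/
def connDenom : MvPolynomial κ R := ∏ i, (1 - MvPolynomial.C q * MvPolynomial.X i)

/-- `μ ↦ 1 - q x_μ` is multiplicative, so `1 - q x_{-μ}` inverts `1 - q x_μ`. -/
lemma isUnit_polyToConn_connDenom : IsUnit (polyToConn q e (connDenom q)) := by
  rw [connDenom, map_prod]
  refine IsUnit.prod_univ_iff.mpr fun i => ?_
  rw [polyToConn, map_sub, map_mul, map_one, MvPolynomial.aeval_X, MvPolynomial.aeval_C]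
  refine IsUnit.of_mul_eq_one (1 - algebraMap R _ q * connVar q (-e i)) ?_
  linear_combination (-algebraMap R (ConnAlgebra q L) q) * connVar_add_neg q (e i)

/-- The elements that become polynomials in the `x_i` after multiplication by a power of the
product of the `1 - q x_i`. -/
def connFractions : Subalgebra R (ConnAlgebra q L) where
  carrier := {a | ∃ n : ℕ, polyToConn q e (connDenom q) ^ n * a ∈ (polyToConn q e).range}
  mul_mem' := by
    rintro a a' ⟨n, h⟩ ⟨n', h'⟩
    refine ⟨n + n', ?_⟩
    have := mul_mem h h'
    rwa [mul_mul_mul_comm, ← pow_add] at this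
  add_mem' := by
    rintro a a' ⟨n, h⟩ ⟨n', h'⟩
    refine ⟨n + n', ?_⟩
    have hd : polyToConn q e (connDenom q) ∈ (polyToConn q e).range := ⟨_, rfl⟩
    have h1 := add_mem (mul_mem (pow_mem hd n') h) (mul_mem (pow_mem hd n) h')
    convert h1 using 1
    ring
  algebraMap_mem' r := ⟨0, by
    rw [pow_zero, one_mul]
    exact Subalgebra.algebraMap_mem _ r⟩

lemma connVar_mem_connFractions (μ : L) : connVar q μ ∈ connFractions q e := by
  classical
  -- Membership is required for both `μ` and `-μ`, which makes closure under negation automatic; it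
  -- remains to check basis vectors.
  let A : AddSubgroup L :=
    { carrier := {μ | connVar q μ ∈ connFractions q e ∧ connVar q (-μ) ∈ connFractions q e}
      zero_mem' := by simp [connVar_zero, zero_mem]
      neg_mem' := fun {μ} h => ⟨h.2, by simpa using h.1⟩
      add_mem' := fun {μ ν} h h' => by
        have hadd : ∀ {μ ν}, connVar q μ ∈ connFractions q e → connVar q ν ∈ connFractions q e →
            connVar q (μ + ν) ∈ connFractions q e := fun h h' => by
          rw [connVar_add]
          exact sub_mem (add_mem h h') (mul_mem (mul_mem (Subalgebra.algebraMap_mem _ q) h) h')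
        refine ⟨hadd h.1 h'.1, ?_⟩
        rw [neg_add]
        exact hadd h.2 h'.2 }
  suffices h : μ ∈ A from h.1
  have hA : AddSubgroup.toIntSubmodule A = ⊤ := by
    rw [eq_top_iff, ← e.span_eq, Submodule.span_le]
    rintro _ ⟨i, rfl⟩
    -- The second witness comes from `(1 - q x_i) x_{-e_i} = -x_i`, multiplied by the remaining
    -- factors of the denominator.
    refine ⟨⟨0, MvPolynomial.X i, ?_⟩, ⟨1, -MvPolynomial.X i *
      ∏ j ∈ Finset.univ.erase i, (1 - MvPolynomial.C q * MvPolynomial.X j), ?_⟩⟩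
    · change polyToConn q e _ = _
      rw [polyToConn, MvPolynomial.aeval_X, pow_zero, one_mul]
    · change polyToConn q e _ = _
      rw [connDenom, ← Finset.mul_prod_erase _ _ (Finset.mem_univ i), pow_one, map_mul, map_mul]
      have h : polyToConn q e (-MvPolynomial.X i) =
          polyToConn q e (1 - MvPolynomial.C q * MvPolynomial.X i) * connVar q (-e i) := by
        rw [polyToConn, map_neg, map_sub, map_mul, map_one, MvPolynomial.aeval_X,
          MvPolynomial.aeval_C]
        linear_combination -connVar_add_neg q (e i)
      rw [h]
      ring
  have : μ ∈ AddSubgroup.toIntSubmodule A := by rw [hA]; trivial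
  exact this

/-- Up to a unit every element is a polynomial in the `x_i`, and polynomials embed in power series.
Being a domain and the nonvanishing of the `x_μ` are inherited from the power series ring through
this embedding. -/
lemma connToSeries_injective : Function.Injective (connToSeries q e) := by
  rw [injective_iff_map_eq_zero]
  intro a ha
  have h : ∀ p : MvPolynomial L R, Ideal.Quotient.mk (connIdeal q L) p ∈ connFractions q e := by
    intro p
    induction p using MvPolynomial.induction_on with
    | C r => exact Subalgebra.algebraMap_mem _ r
    | add p p' hp hp' => rw [map_add]; exact add_mem hp hp'
    | mul_X p μ hp => rw [map_mul]; exact mul_mem hp (connVar_mem_connFractions q e μ)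
  obtain ⟨p', rfl⟩ := Ideal.Quotient.mk_surjective a
  obtain ⟨n, p, hp⟩ := h p'
  have hp' := congrArg (connToSeries q e) hp
  change connToSeries q e (polyToConn q e p) = _ at hp'
  rw [map_mul, ha, mul_zero, connToSeries_polyToConn] at hp'
  have hp0 : p = 0 := MvPolynomial.coe_injective κ R (by rw [hp', MvPolynomial.coe_zero])
  change polyToConn q e p = _ at hp
  rw [hp0, map_zero] at hp
  exact ((isUnit_polyToConn_connDenom q e).pow n).mul_right_eq_zero.mp hp.symm

end

section

variable {R : Type*} [CommRing R] (q : R) {L : Type*} [AddCommGroup L]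

/-- The polynomial formal group algebra of a lattice. -/
def connectiveModel (L : Type*) [AddCommGroup L] : LatticeModel L where
  carrier := ConnAlgebra q L
  x := connVar q
  map := connHom q
  map_x := connHom_var q
  map_id := connHom_id q
  map_comp := connHom_comp q
  x_zero := connVar_zero q
  mul_dvd_add μ := ⟨algebraMap R _ q, by linear_combination connVar_add_neg q μ⟩
  dvd_sub_map _ _ hg p := connVar_dvd_sub_map q hg p

variable [IsDomain R] {κ : Type*} [Finite κ] (e : Module.Basis κ ℤ L)

include e in
lemma isDomain_connAlgebra : IsDomain (ConnAlgebra q L) := by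
  cases nonempty_fintype κ
  have : IsDomain (MvPowerSeries κ R) := NoZeroDivisors.to_isDomain _
  exact (connToSeries_injective q e).isDomain (connToSeries q e)

include e in
omit [Finite κ] in
lemma connVar_ne_zero [CharZero R] {μ : L} (hμ : μ ≠ 0) : connVar q μ ≠ 0 := fun h =>
  fgaVar_ne_zero (connectiveGroup q) e hμ (by rw [← connToSeries_var, h, map_zero])

end

section

open RootPairing

variable {ι L N : Type*} [AddCommGroup L] [AddCommGroup N] {P : RootPairing ι ℤ L N} {b : P.Base}
  {θ : ι} {I : AffineWeyl P → List (AffineIndex b)} {R : Type*} [CommRing R] [IsDomain R]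
  [CharZero R]

theorem connectiveRing_expansion [Finite ι] [P.IsReduced] (q : R)
    (hθ : IsHighestRoot b θ) (hI : IsWCompatible b θ I) (u : AffineWeyl P) :
    ∃ c : AffineWeyl P →₀ (connectiveRing P q).carrier, (∀ v ∈ minReps b θ, c v = 0) ∧
      (connectiveRing P q).k
          ((connectiveRing P q).pr ((connectiveRing P q).demazureSeq b θ (I u))) =
        (connectiveRing P q).demazureSeq b θ (I u) +
          c.sum fun v a => algebraMap _ (connectiveRing P q).Q a •
            (connectiveRing P q).demazureSeq b θ (I v) := by
  have : IsDomain (connectiveModel q (AffineLattice P)).carrier :=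
    isDomain_connAlgebra q (affineBasis b)
  refine (connectiveRing P q).exists_k_pr_expansion (connectiveModel q (AffineLattice P))
    (fun μ hμ => connVar_ne_zero q (affineBasis b) hμ)
    (connHom q (forgetDelta P))
    (fun μ => connHom_var q (forgetDelta P) μ) (fun w p => ?_) (fun i f => ?_)
    hθ hI u
  · refine (RingHom.congr_fun (connHom_comp q (forgetDelta P) (affineEnd w)) p).symm.trans ?_
    rw [forgetDelta_comp_affineEnd]
    exact RingHom.congr_fun (connHom_comp q (DistribSMul.toAddMonoidHom L w.right) _) p
  · exact connVar_dvd_sub_map q (fun μ => ⟨-P.toLinearMap μ (P.coroot i),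
      (ofIdx_smul_eq P i μ).trans (by rw [neg_smul, sub_eq_add_neg])⟩) f

end

end AffineFADA
end

open AffineFADA in
theorem theorem5
    -- the root datum of a simple, simply connected group, with simple roots and highest root
    {ι L N : Type*} [Finite ι] [AddCommGroup L] [AddCommGroup N]
    (P : RootPairing ι ℤ L N) [P.IsReduced] (hP : IsSimple P)
    (hsc : Submodule.span ℤ (Set.range P.coroot) = ⊤)
    (b : P.Base) (θ : ι) (hθ : IsHighestRoot b θ)
    -- the coefficient domain of characteristic zero and the formal group law
    {R : Type*} [CommRing R] [IsDomain R] [CharZero R] (F : FormalGroup R) [F.IsComm]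
    {κ : Type*} [Finite κ] (e : Module.Basis κ ℤ L)
    -- a W-compatible choice of reduced sequences
    (I : AffineWeyl P → List (AffineIndex b)) (hI : IsWCompatible b θ I)
    (u : AffineWeyl P) (hu : u ∈ minReps b θ) :
    -- for the formal group algebra
    (∃ c : AffineWeyl P →₀ (powerSeriesRing P F e).carrier,
      (∀ v ∈ minReps b θ, c v = 0) ∧
      (powerSeriesRing P F e).k
          ((powerSeriesRing P F e).pr ((powerSeriesRing P F e).demazureSeq b θ (I u))) =
        (powerSeriesRing P F e).demazureSeq b θ (I u) +
          c.sum fun v a => algebraMap _ (powerSeriesRing P F e).Q a •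
            (powerSeriesRing P F e).demazureSeq b θ (I v)) ∧
    -- for its polynomial version, when the formal group law is `x + y - q x y`
    (∀ q : R, ∃ c : AffineWeyl P →₀ (connectiveRing P q).carrier,
      (∀ v ∈ minReps b θ, c v = 0) ∧
      (connectiveRing P q).k
          ((connectiveRing P q).pr ((connectiveRing P q).demazureSeq b θ (I u))) =
        (connectiveRing P q).demazureSeq b θ (I u) +
          c.sum fun v a => algebraMap _ (connectiveRing P q).Q a •
            (connectiveRing P q).demazureSeq b θ (I v)) := by
  exact ⟨powerSeriesRing_expansion F e hθ hI u,
    fun q => connectiveRing_expansion q hθ hI u⟩
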